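/- Setting. Let $\mathcal A$ be the space of smooth $SU(2)$ connections $A = A^i_a\tau_i\,dx^a$ on $\mathbb R^3$, $\tau_i=-\tfrac i2\sigma_i$, and for a piecewise analytic path $\ell$ (a finite composition of regular analytic arcs) let $A(\ell)\in SU(2)$ be the holonomy of $A$ along $\ell$. Let $\mathrm{Cyl}$ be the algebra of functions $\Phi:\mathcal A\to\mathbb C$ that are uniform limits of functions $A\mapsto F(A(\ell_1),\dots,A(\ell_n))$ with $n\in\mathbb N$, piecewise analytic paths $\ell_1,\dots,\ell_n$ and $F:SU(2)^n\to\mathbb C$ continuous. Let $\mathring A\neq0$ be a connection that is invariant under the Euclidean group, which acts by $((x,R)\rhd A)^i_a = R^i{}_j\,(\phi_{(x,R)})_*A^j_a$ with $\phi_{(x,R)}(y)=Ry+x$, and put $r(c):=c\mathring A$ for $c\in\mathbb R$. Define the following complex vector spaces of functions $\mathbb R\to\mathbb C$: - $\mathrm{Cyl}_F:=r^*[\mathrm{Cyl}]=\{\Phi\circ r:\Phi\in\mathrm{Cyl}\}$; - $\mathrm{Cyl}_S$, the almost periodic functions, i.e. the uniform limits of finite linear combinations of the exponentials $c\mapsto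 e^{i\mu c}$, $\mu\in\mathbb R$; - $\mathscr V$, the continuous functions that vanish at $\pm\infty$. For a complex vector space $W$ let $W^*$ denote its algebraic dual. Lemma. One has $\mathrm{Cyl}_F=\mathrm{Cyl}_S\oplus\mathscr V$ as vector spaces; let $P_S:\mathrm{Cyl}_F\to\mathrm{Cyl}_S$ and $P_V:\mathrm{Cyl}_F\to\mathscr V$ be the canonical projections. Then the map $f:\mathrm{Cyl}_S^*\oplus\mathscr V^*\to\mathrm{Cyl}_F^*$ given by $$(f(\psi_S,\psi_V)|\phi\rangle=(\psi_S|P_S\phi\rangle+(\psi_V|P_V\phi\rangle\qquad(\phi\in\mathrm{Cyl}_F)$$ is a bijection. It is linear, and so a natural isomorphism of vector spaces $\mathrm{Cyl}_S^*\oplus\mathscr V^*\cong\mathrm{Cyl}_F^*$. -/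

import Mathlib

open scoped Matrix ContDiff

noncomputable section

namespace LQC

/-! ### Connections and holonomies in full loop quantum gravity -/

/-- Space is `ℝ³`, in Cartesian coordinates. -/
abbrev Space : Type := Fin 3 → ℝ

/-- The Lie group `SU(2)`, with the topology of a subspace of the `2 × 2` matrices. -/
abbrev SU2 : Type := Matrix.specialUnitaryGroup (Fin 2) ℂ

/-- The Pauli matrices. -/
def pauli : Fin 3 → Matrix (Fin 2) (Fin 2) ℂ :=
  ![!![0, 1; 1, 0], !![0, -Complex.I; Complex.I, 0], !![1, 0; 0, -1]]

/-- The basis `τ_i = -(i/2) σ_i` of `su(2)`. -/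
def tau (i : Fin 3) : Matrix (Fin 2) (Fin 2) ℂ := (-(Complex.I / 2)) • pauli i

/-- A smooth `SU(2)` connection `A_a = A^i_a τ_i` on `ℝ³`, given by its components:
`coeff x a i` is `A^i_a(x)`. -/
@[ext] structure Connection where
  coeff : Space → Fin 3 → Fin 3 → ℝ
  smooth : ContDiff ℝ ∞ coeff

/-- The element `A_a(x) v^a = A^i_a(x) v^a τ_i` of `su(2)`. -/
def Connection.eval (A : Connection) (x v : Space) : Matrix (Fin 2) (Fin 2) ℂ :=
  ∑ a, ∑ i, ((A.coeff x a i * v a : ℝ) : ℂ) • tau i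

/-- A regular analytic arc in `ℝ³`, parametrized by `[0, 1]`. The values of `toFun` away from
`[0, 1]` play no role. -/
structure AnalyticArc where
  toFun : ℝ → Space
  analytic : AnalyticOnNhd ℝ toFun (Set.Icc 0 1)
  regular : ∀ t ∈ Set.Icc (0 : ℝ) 1, deriv toFun t ≠ 0

/-- A piecewise analytic path: finitely many analytic arcs, each of which starts where the
preceding one ends. -/
structure PiecewiseAnalyticPath where
  arcs : List AnalyticArc
  chain : arcs.IsChain fun e e' => e.toFun 1 = e'.toFun 0

/-- `U` is the parallel transport of `A` along the arc `e`: `U(0) = 1` and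
`U'(t) = -A_a(e(t)) e'(t)^a U(t)` on `[0, 1]`. -/
def IsParallelTransport (A : Connection) (e : AnalyticArc) (U : ℝ → SU2) : Prop :=
  U 0 = 1 ∧ ∀ t ∈ Set.Icc (0 : ℝ) 1, ∀ i j : Fin 2,
    HasDerivWithinAt (fun s => (U s : Matrix (Fin 2) (Fin 2) ℂ) i j)
      ((-(A.eval (e.toFun t) (deriv e.toFun t)) * (U t : Matrix (Fin 2) (Fin 2) ℂ)) i j)
      (Set.Icc 0 1) t

open Classical in
/-- The holonomy of `A` along an arc, that is `U(1)` for the parallel transport `U`. (The linear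
equation for `U` has a solution, and the solution is unique on `[0, 1]`.) -/
def arcHolonomy (A : Connection) (e : AnalyticArc) : SU2 :=
  if h : ∃ U, IsParallelTransport A e U then h.choose 1 else 1

/-- The ordered product of the holonomies along a list of arcs, the last arc on the left. -/
def listHolonomy (A : Connection) : List AnalyticArc → SU2
  | [] => 1
  | e :: l => listHolonomy A l * arcHolonomy A e

/-- The holonomy `A(ℓ)` of `A` along a piecewise analytic path `ℓ`. -/
def holonomy (A : Connection) (l : PiecewiseAnalyticPath) : SU2 := listHolonomy A l.arcs

/-! ### Spaces of functions -/

/-- The set of all uniform limits of elements of a space of complex functions. -/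
def uniformClosure {X : Type*} (S : Submodule ℂ (X → ℂ)) : Submodule ℂ (X → ℂ) where
  carrier := {f | ∀ ε : ℝ, 0 < ε → ∃ g ∈ S, ∀ x, ‖f x - g x‖ ≤ ε}
  zero_mem' := fun ε hε => ⟨0, S.zero_mem, fun x => by simpa using hε.le⟩
  add_mem' := by
    intro f₁ f₂ h₁ h₂ ε hε
    obtain ⟨g₁, hg₁, h₁⟩ := h₁ (ε / 2) (by positivity)
    obtain ⟨g₂, hg₂, h₂⟩ := h₂ (ε / 2) (by positivity)
    refine ⟨g₁ + g₂, S.add_mem hg₁ hg₂, fun x => ?_⟩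
    have h : (f₁ + f₂) x - (g₁ + g₂) x = (f₁ x - g₁ x) + (f₂ x - g₂ x) := by
      simp only [Pi.add_apply]; ring
    rw [h]
    linarith [norm_add_le (f₁ x - g₁ x) (f₂ x - g₂ x), h₁ x, h₂ x]
  smul_mem' := by
    intro a f hf ε hε
    obtain ⟨g, hg, h⟩ := hf (ε / (‖a‖ + 1)) (by positivity)
    refine ⟨a • g, S.smul_mem a hg, fun x => ?_⟩
    have h' : (a • f) x - (a • g) x = a * (f x - g x) := by
      simp only [Pi.smul_apply, smul_eq_mul]; ring
    rw [h', norm_mul]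
    calc ‖a‖ * ‖f x - g x‖ ≤ (‖a‖ + 1) * (ε / (‖a‖ + 1)) := by
          gcongr
          · linarith
          · exact h x
      _ = ε := by field_simp

/-- Functions `A ↦ F(A(ℓ₁), …, A(ℓₙ))` of the connection, where `ℓ₁, …, ℓₙ` are piecewise analytic
paths and `F : SU(2)ⁿ → ℂ` is continuous. -/
def CylFinite : Submodule ℂ (Connection → ℂ) where
  carrier := {Φ | ∃ (n : ℕ) (l : Fin n → PiecewiseAnalyticPath) (F : C(Fin n → SU2, ℂ)),
    ∀ A, Φ A = F fun k => holonomy A (l k)}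
  zero_mem' := ⟨0, Fin.elim0, 0, fun _ => rfl⟩
  add_mem' := by
    rintro Φ₁ Φ₂ ⟨n, l, F, h₁⟩ ⟨m, l', G, h₂⟩
    refine ⟨n + m, Fin.append l l',
      ⟨fun u => F (fun k => u (Fin.castAdd m k)) + G (fun k => u (Fin.natAdd n k)),
        by fun_prop⟩, fun A => ?_⟩
    simp [h₁, h₂]
  smul_mem' := by
    rintro a Φ ⟨n, l, F, h⟩
    exact ⟨n, l, a • F, fun A => by simp [h]⟩

/-- The configuration algebra `Cyl` of loop quantum gravity, complete in the supremum norm. -/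
def Cyl : Submodule ℂ (Connection → ℂ) := uniformClosure CylFinite

/-- `A` is homogeneous and isotropic: it is fixed by the action
`((x, R) ▷ A)^i_a = R^i_j (φ_* A^j)_a` of the Euclidean group, where `φ(y) = R y + x`. -/
def Connection.IsEuclideanInvariant (A : Connection) : Prop :=
  ∀ (R : Matrix.specialOrthogonalGroup (Fin 3) ℝ) (x y : Space) (a i : Fin 3),
    ∑ b, ∑ j, R.1 a b * R.1 i j * A.coeff y b j = A.coeff (R.1 *ᵥ y + x) a i

/-- The map `r : c ↦ c A` from the real line to connections. -/
def ray (A : Connection) (c : ℝ) : Connection where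
  coeff := c • A.coeff
  smooth := contDiff_const.smul A.smooth

/-- `Cyl_F = r^*[Cyl]`, the restrictions `c ↦ Φ(c A)` of the elements `Φ` of `Cyl`. -/
def CylF (A : Connection) : Submodule ℂ (ℝ → ℂ) := Cyl.map (LinearMap.funLeft ℂ ℂ (ray A))

/-- `Cyl_S`: the almost periodic functions on the real line, that is, the uniform limits of linear
combinations of the exponentials `c ↦ e^{iμc}` with `μ` real. -/
def CylS : Submodule ℂ (ℝ → ℂ) :=
  uniformClosure (Submodule.span ℂ
    (Set.range fun (μ c : ℝ) => Complex.exp (Complex.I * (μ : ℂ) * (c : ℂ))))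

/-- The continuous functions on the real line that vanish at `±∞`. -/
def VanishingAtInfinity : Submodule ℂ (ℝ → ℂ) where
  carrier := {f | Continuous f ∧ Filter.Tendsto f (Filter.cocompact ℝ) (nhds 0)}
  zero_mem' := ⟨continuous_const, tendsto_const_nhds⟩
  add_mem' := fun hf hg => ⟨hf.1.add hg.1, by
    have h := hf.2.add hg.2
    rwa [add_zero] at h⟩
  smul_mem' := fun a _ hf => ⟨hf.1.const_smul a, by
    have h := hf.2.const_smul a
    rwa [smul_zero] at h⟩

/-! ### Direct sums, their projections and their duals -/

section DirectSum

/-- `W = S ⊕ V`, for subspaces `S`, `V` and `W` of one vector space. -/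
structure IsDirectSum {E : Type*} [AddCommGroup E] [Module ℂ E] (W S V : Submodule ℂ E) : Prop where
  left_le : S ≤ W
  right_le : V ≤ W
  isCompl : IsCompl (S.submoduleOf W) (V.submoduleOf W)

variable {E : Type*} [AddCommGroup E] [Module ℂ E] {W S V : Submodule ℂ E}

/-- The canonical projection `W → S` if `W = S ⊕ V`. -/
def IsDirectSum.projLeft (h : IsDirectSum W S V) : W →ₗ[ℂ] S :=
  (Submodule.submoduleOfEquivOfLe h.left_le).toLinearMap ∘ₗ
    Submodule.projectionOnto _ _ h.isCompl

/-- The canonical projection `W → V` if `W = S ⊕ V`. -/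
def IsDirectSum.projRight (h : IsDirectSum W S V) : W →ₗ[ℂ] V :=
  (Submodule.submoduleOfEquivOfLe h.right_le).toLinearMap ∘ₗ
    Submodule.projectionOnto _ _ h.isCompl.symm

theorem IsDirectSum.projLeft_add_projRight (h : IsDirectSum W S V) (φ : W) :
    (h.projLeft φ : E) + (h.projRight φ : E) = φ :=
  congrArg Subtype.val (Submodule.projection_add_projection_eq_self h.isCompl φ)

/-- The map `f : S^* ⊕ V^* → W^*`, `(f(ψ_S, ψ_V) | φ⟩ = (ψ_S | P_S φ⟩ + (ψ_V | P_V φ⟩`, of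
algebraic duals. -/
def IsDirectSum.dualMap (h : IsDirectSum W S V) (ψ : Module.Dual ℂ S × Module.Dual ℂ V) :
    Module.Dual ℂ W :=
  ψ.1 ∘ₗ h.projLeft + ψ.2 ∘ₗ h.projRight

end DirectSum

end LQC

end

noncomputable section

namespace LQC

open Quaternion Set

/-! ### Linear differential equations for quaternions -/

/-! Euclidean invariance forces the reference connection to be `k δ^i_a`, with `k ≠ 0`. On the ray
`c ↦ cA`, parallel transport along an arc `e` then becomes the equation `u' = -(ck/2) e' u` for unit
quaternions, with `e'` read as an imaginary quaternion. Everything rests on how its solutions depend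
on `c`.

Upper bound for `CylF`: as `|c| → ∞` the solution turns with the tangent and oscillates with a
frequency fixed by the length of the arc, up to an error `O(1/|c|)`
(`exists_norm_sub_le_of_rapidly_rotating`). Matrix entries of holonomies are therefore trigonometric
polynomials plus functions vanishing at infinity. These sums form a star algebra, and
Stone–Weierstrass on the compact space `SU(2)^n` extends the conclusion, after uniform closure, to
every continuous `F`. The limits stay in `CylS ⊔ VanishingAtInfinity` because almost periodic
functions recur: the sup norm of `a` is at most that of `a + v` (`CylS.norm_le_of_norm_add_le`). The
same inequality makes the sum direct.

Lower bound: straight lines produce all exponentials. Circular arcs produce functions `sin ω / (2ω)`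
that vanish at infinity, where `ω` is the frequency of rotation. Together with the exponentials they
separate the points of the one-point compactification of the line, so Stone–Weierstrass yields all
of `VanishingAtInfinity`. Passing to uniform limits requires `CylF` to be closed, that is, a uniform
limit on the ray must lift to all connections (`uniformClosure_map_cylFinite_le`).

The duality statement is then pure linear algebra: a functional on a direct sum is determined by its
restrictions to the summands, which are arbitrary. -/

theorem star_eq_neg_of_re_eq_zero {p : ℍ[ℝ]} (h : p.re = 0) : star p = -p := by
  ext <;> simp [h]

theorem mul_self_of_re_eq_zero {p : ℍ[ℝ]} (h : p.re = 0) : p * p = -((‖p‖ ^ 2 : ℝ) : ℍ[ℝ]) := by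
  have h1 := Quaternion.self_mul_star p
  rw [star_eq_neg_of_re_eq_zero h, normSq_eq_norm_mul_self, mul_neg] at h1
  rw [pow_two, ← h1, neg_neg]

theorem hasDerivWithinAt_star {u : ℝ → ℍ[ℝ]} {u' : ℍ[ℝ]} {s : Set ℝ} {t : ℝ}
    (h : HasDerivWithinAt u u' s t) : HasDerivWithinAt (fun x => star (u x)) (star u') s t :=
  (LinearMap.toContinuousLinearMap
    ({ toFun := star, map_add' := star_add, map_smul' := fun r x => by ext <;> simp } :
      ℍ[ℝ] →ₗ[ℝ] ℍ[ℝ])).hasFDerivAt.comp_hasDerivWithinAt t h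

theorem hasDerivWithinAt_coe {f : ℝ → ℝ} {f' : ℝ} {s : Set ℝ} {t : ℝ}
    (h : HasDerivWithinAt f f' s t) :
    HasDerivWithinAt (fun x => (f x : ℍ[ℝ])) (f' : ℍ[ℝ]) s t := by
  have h1 := h.smul_const (1 : ℍ[ℝ])
  have h2 : ∀ x : ℝ, x • (1 : ℍ[ℝ]) = (x : ℍ[ℝ]) := fun x => by
    rw [← Quaternion.coe_mul_eq_smul, mul_one]
  simpa only [h2] using h1

/-- Left multiplication by an imaginary quaternion is skew for the inner product, so `‖u‖ ^ 2` has
derivative `2⟨u, B u⟩ = 0`. -/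
theorem norm_eq_of_hasDerivWithinAt {B u : ℝ → ℍ[ℝ]} (hB : ∀ t ∈ Icc (0 : ℝ) 1, (B t).re = 0)
    (hu : ∀ t ∈ Icc (0 : ℝ) 1, HasDerivWithinAt u (B t * u t) (Icc 0 1) t) :
    ∀ t ∈ Icc (0 : ℝ) 1, ‖u t‖ = ‖u 0‖ := by
  have h : ∀ t ∈ Icc (0 : ℝ) 1, HasDerivWithinAt (fun s => ‖u s‖ ^ 2) 0 (Icc 0 1) t := by
    intro t ht
    convert (hu t ht).norm_sq using 1
    have hb := star_eq_neg_of_re_eq_zero (hB t ht)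
    have : u t * star (B t * u t) = normSq (u t) • star (B t) := by
      rw [star_mul, ← mul_assoc, Quaternion.self_mul_star, Quaternion.coe_mul_eq_smul]
    rw [Quaternion.inner_def, this]
    simp [hB t ht]
  intro t ht
  have h2 := norm_image_sub_le_of_norm_deriv_le_segment' h (C := 0) (by simp) t ht
  have h3 : ‖u t‖ ^ 2 = ‖u 0‖ ^ 2 := by
    rw [zero_mul, norm_le_zero_iff, sub_eq_zero] at h2
    exact h2
  exact (pow_left_inj₀ (norm_nonneg _) (norm_nonneg _) two_ne_zero).1 h3

/-- In the derivative of `star u * v` only `B' - B` survives, between two unit quaternions. Since `u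
1` is a unit, the distance of `star (u 1) * v 1` from `1` is `‖u 1 - v 1‖`. -/
theorem norm_sub_le_of_hasDerivWithinAt {B B' u v : ℝ → ℍ[ℝ]} {C : ℝ}
    (hB : ∀ t ∈ Icc (0 : ℝ) 1, (B t).re = 0) (hB' : ∀ t ∈ Icc (0 : ℝ) 1, (B' t).re = 0)
    (hC : ∀ t ∈ Icc (0 : ℝ) 1, ‖B t - B' t‖ ≤ C) (hu0 : u 0 = 1) (hv0 : v 0 = 1)
    (hu : ∀ t ∈ Icc (0 : ℝ) 1, HasDerivWithinAt u (B t * u t) (Icc 0 1) t)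
    (hv : ∀ t ∈ Icc (0 : ℝ) 1, HasDerivWithinAt v (B' t * v t) (Icc 0 1) t) :
    ‖u 1 - v 1‖ ≤ C := by
  have h : ∀ t ∈ Icc (0 : ℝ) 1, HasDerivWithinAt (fun s => star (u s) * v s)
      (star (u t) * (B' t - B t) * v t) (Icc 0 1) t := by
    intro t ht
    refine ((hasDerivWithinAt_star (hu t ht)).mul (hv t ht)).congr_deriv ?_
    rw [star_mul, star_eq_neg_of_re_eq_zero (hB t ht)]
    noncomm_ring
  have hun : ∀ t ∈ Icc (0 : ℝ) 1, ‖u t‖ = 1 := fun t ht => by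
    rw [norm_eq_of_hasDerivWithinAt hB hu t ht, hu0, norm_one]
  have hvn : ∀ t ∈ Icc (0 : ℝ) 1, ‖v t‖ = 1 := fun t ht => by
    rw [norm_eq_of_hasDerivWithinAt hB' hv t ht, hv0, norm_one]
  have h1 : (1 : ℝ) ∈ Icc (0 : ℝ) 1 := by simp
  have key := norm_image_sub_le_of_norm_deriv_le_segment_01' h (C := C) (fun t ht => by
    have ht' := Ico_subset_Icc_self ht
    rw [norm_mul, norm_mul, _root_.norm_star, hun t ht', hvn t ht', one_mul, mul_one, norm_sub_rev]
    exact hC t ht')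
  simp only [hu0, hv0, star_one, mul_one] at key
  have h2 : star (u 1) * v 1 - 1 = star (u 1) * (v 1 - u 1) := by
    rw [mul_sub, Quaternion.star_mul_self, normSq_eq_norm_mul_self, hun 1 h1]
    simp
  rwa [h2, norm_mul, _root_.norm_star, hun 1 h1, one_mul, norm_sub_rev] at key

theorem exists_quaternion_solution {B : ℝ → ℍ[ℝ]} (hB : ∀ t ∈ Icc (0 : ℝ) 1, (B t).re = 0)
    (hc : ContinuousOn B (Icc 0 1)) :
    ∃ u : ℝ → ℍ[ℝ], u 0 = 1 ∧
      ∀ t ∈ Icc (0 : ℝ) 1, HasDerivWithinAt u (B t * u t) (Icc 0 1) t := by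
  obtain ⟨M, hM⟩ := isCompact_Icc.exists_bound_of_continuousOn hc
  -- The cutoff makes the field globally bounded and Lipschitz, so Picard–Lindelöf covers all of
  -- `[0, 1]`. The cut-off coefficient is still imaginary, so the solution stays on the unit sphere,
  -- where the cutoff equals `1`.
  let φ : ContDiffBump (0 : ℍ[ℝ]) := ⟨2, 3, by norm_num, by norm_num⟩
  have hφ : ContDiff ℝ 1 fun x : ℍ[ℝ] => φ x • x := φ.contDiff.smul contDiff_id
  have hs : HasCompactSupport fun x : ℍ[ℝ] => φ x • x := φ.hasCompactSupport.smul_right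
  obtain ⟨K, hK⟩ := ContDiff.lipschitzWith_of_hasCompactSupport hs hφ (by simp)
  obtain ⟨R, hR⟩ := hs.exists_bound_of_continuous hφ.continuous
  have hM0 : 0 ≤ M := (norm_nonneg _).trans (hM 0 (by simp))
  have hR0 : 0 ≤ R := (norm_nonneg _).trans (hR 0)
  have hPL : IsPicardLindelof (fun t x => B t * (φ x • x))
      (⟨0, by simp⟩ : Icc (0 : ℝ) 1) (1 : ℍ[ℝ]) (M * R).toNNReal 0 (M * R).toNNReal
      (M.toNNReal * K) := by
    refine ⟨fun t ht => ?_, fun x _ => ?_, fun t ht x _ => ?_, ?_⟩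
    · refine (LipschitzWith.of_dist_le_mul fun x y => ?_).lipschitzOnWith
      rw [dist_eq_norm, ← mul_sub, norm_mul, NNReal.coe_mul, mul_assoc]
      have h1 := hK.dist_le_mul x y
      rw [dist_eq_norm] at h1
      rw [Real.coe_toNNReal _ hM0]
      exact mul_le_mul (hM t ht) h1 (norm_nonneg _) hM0
    · exact hc.mul continuousOn_const
    · rw [norm_mul, Real.coe_toNNReal _ (mul_nonneg hM0 hR0)]
      exact mul_le_mul (hM t ht) (hR x) (norm_nonneg _) hM0
    · show (((M * R).toNNReal : NNReal) : ℝ) * max (1 - 0) (0 - 0) ≤ ((M * R).toNNReal : ℝ) - 0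
      norm_num
  obtain ⟨u, hu0, hu⟩ := hPL.exists_eq_forall_mem_Icc_hasDerivWithinAt₀
  refine ⟨u, hu0, ?_⟩
  have hu' : ∀ t ∈ Icc (0 : ℝ) 1, HasDerivWithinAt u ((φ (u t) • B t) * u t) (Icc 0 1) t := by
    intro t ht
    refine (hu t ht).congr_deriv ?_
    rw [smul_mul_assoc, mul_smul_comm]
  have hn := norm_eq_of_hasDerivWithinAt (fun t ht => by simp [hB t ht]) hu'
  intro t ht
  have h1 : φ (u t) = 1 := by
    apply φ.one_of_mem_closedBall
    have := hn t ht
    rw [show u 0 = 1 from hu0, norm_one] at this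
    rw [mem_closedBall_zero_iff, this]
    show (1 : ℝ) ≤ 2
    norm_num
  simpa [h1] using hu' t ht

/-- Solutions of `u' = -(k/2) p u` for large `k`: up to an error of order `1/k`, they turn with the
direction of `p` and oscillate with frequency half the length of the curve. -/
theorem exists_norm_sub_le_of_rapidly_rotating {p : ℝ → ℍ[ℝ]} (hp : AnalyticOnNhd ℝ p (Icc 0 1))
    (hre : ∀ t, (p t).re = 0) (h0 : ∀ t ∈ Icc (0 : ℝ) 1, p t ≠ 0) :
    ∃ (g₁ n₀ : ℍ[ℝ]) (L C : ℝ), ∀ (k : ℝ) (u : ℝ → ℍ[ℝ]), u 0 = 1 →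
      (∀ t ∈ Icc (0 : ℝ) 1, HasDerivWithinAt u ((-(k / 2)) • p t * u t) (Icc 0 1) t) →
      |k| * ‖u 1 - g₁ * (((Real.cos (k * L / 2) : ℝ) : ℍ[ℝ])
        - ((Real.sin (k * L / 2) : ℝ) : ℍ[ℝ]) * n₀)‖ ≤ C := by
  have hs0 : ∀ t ∈ Icc (0 : ℝ) 1, ‖p t‖ ≠ 0 := fun t ht => norm_ne_zero_iff.2 (h0 t ht)
  set n : ℝ → ℍ[ℝ] := fun t => ‖p t‖⁻¹ • p t with hn
  have hnorm : AnalyticOnNhd ℝ (fun t => ‖p t‖) (Icc 0 1) := fun t ht =>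
    ((hp t ht).contDiffAt.norm ℝ (h0 t ht)).analyticAt
  have hna : AnalyticOnNhd ℝ n (Icc 0 1) := fun t ht =>
    ((hnorm t ht).inv (hs0 t ht)).smul (hp t ht)
  set d : ℝ → ℍ[ℝ] := deriv n with hd
  have hda : AnalyticOnNhd ℝ d (Icc 0 1) := hna.deriv
  -- First-order corrector: since `d` anticommutes with `n`, `p q - q p = n d`, which is what
  -- cancels the order-`k` term in `hY`.
  set q : ℝ → ℍ[ℝ] := fun t => (2 * ‖p t‖)⁻¹ • d t with hq
  have hqa : AnalyticOnNhd ℝ q (Icc 0 1) := fun t ht =>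
    ((analyticAt_const.mul (hnorm t ht)).inv (mul_ne_zero two_ne_zero (hs0 t ht))).smul (hda t ht)
  have hnd : ∀ t ∈ Icc (0 : ℝ) 1, HasDerivAt n (d t) t := fun t ht =>
    (hna t ht).differentiableAt.hasDerivAt
  have hqd : ∀ t ∈ Icc (0 : ℝ) 1, HasDerivAt q (deriv q t) t := fun t ht =>
    (hqa t ht).differentiableAt.hasDerivAt
  have hnre : ∀ t, (n t).re = 0 := fun t => by simp [hn, hre]
  have hnn' : ∀ t, p t ≠ 0 → n t * n t = -1 := by
    intro t ht
    rw [mul_self_of_re_eq_zero (hnre t), hn]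
    simp [norm_smul, norm_ne_zero_iff.2 ht]
  have hnn : ∀ t ∈ Icc (0 : ℝ) 1, n t * n t = -1 := fun t ht => hnn' t (h0 t ht)
  have hanti : ∀ t ∈ Icc (0 : ℝ) 1, d t * n t = -(n t * d t) := by
    intro t ht
    have h1 : HasDerivAt (fun s => n s * n s) (d t * n t + n t * d t) t :=
      (hnd t ht).mul (hnd t ht)
    have h2 : HasDerivAt (fun s => n s * n s) 0 t := by
      refine (hasDerivAt_const t (-1 : ℍ[ℝ])).congr_of_eventuallyEq ?_
      filter_upwards [(hp t ht).continuousAt.eventually_ne (h0 t ht)] with s hs using hnn' s hs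
    exact eq_neg_of_add_eq_zero_left (h1.unique h2)
  -- The rotation that carries the direction `n` along has this generator: `K n - n K = d`. Hence
  -- its solution `g` satisfies `g n(0) = n g`.
  set K : ℝ → ℍ[ℝ] := fun t => (1 / 2 : ℝ) • (n t * d t) with hK
  have hKre : ∀ t ∈ Icc (0 : ℝ) 1, (K t).re = 0 := by
    intro t ht
    have h1 := congrArg QuaternionAlgebra.re (hanti t ht)
    simp only [hK, re_mul, re_neg, re_smul, smul_eq_mul] at h1 ⊢
    linarith
  have hKc : ContinuousOn K (Icc 0 1) :=  by
    have h1 : ContinuousOn (fun t => n t * d t) (Icc 0 1) :=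
      hna.continuousOn.mul hda.continuousOn
    exact h1.const_smul (1 / 2 : ℝ)
  obtain ⟨g, hg0, hg⟩ := exists_quaternion_solution hKre hKc
  have hgn : ∀ t ∈ Icc (0 : ℝ) 1, ‖g t‖ = 1 := fun t ht => by
    rw [norm_eq_of_hasDerivWithinAt hKre hg t ht, hg0, norm_one]
  have hgn0 : ∀ t ∈ Icc (0 : ℝ) 1, g t * n 0 = n t * g t := by
    have h1 : ∀ t ∈ Icc (0 : ℝ) 1,
        HasDerivWithinAt (fun s => star (g s) * n s * g s) 0 (Icc 0 1) t := by
      intro t ht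
      refine (((hasDerivWithinAt_star (hg t ht)).mul (hnd t ht).hasDerivWithinAt).mul
        (hg t ht)).congr_deriv ?_
      rw [star_mul, star_eq_neg_of_re_eq_zero (hKre t ht)]
      have h2 : -K t * n t + d t + n t * K t = 0 := by
        simp only [hK, neg_mul, smul_mul_assoc, mul_smul_comm]
        rw [mul_assoc, hanti t ht, ← mul_assoc, mul_neg, ← mul_assoc, hnn t ht]
        simp only [neg_mul, one_mul, neg_neg, smul_neg]
        module
      calc _ = star (g t) * (-K t * n t + d t + n t * K t) * g t := by
              simp only [Pi.mul_apply]; noncomm_ring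
        _ = 0 := by rw [h2]; simp
    intro t ht
    have h3 := norm_image_sub_le_of_norm_deriv_le_segment' h1 (C := 0) (by simp) t ht
    rw [zero_mul, norm_le_zero_iff, sub_eq_zero, hg0] at h3
    simp only [star_one, one_mul, mul_one] at h3
    rw [← h3, ← mul_assoc, ← mul_assoc, Quaternion.self_mul_star, normSq_eq_norm_mul_self,
      hgn t ht]
    simp
  -- `‖p t‖` is known to be continuous only on `[0, 1]`. With a continuous extension, the
  -- fundamental theorem of calculus applies at the endpoints too.
  set s' : ℝ → ℝ := IccExtend (zero_le_one) (fun t : Icc (0 : ℝ) 1 => ‖p t‖) with hs'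
  have hs'c : Continuous s' :=
    (continuousOn_iff_continuous_domRestrict.1 hnorm.continuousOn).Icc_extend'
  have hs'e : ∀ t ∈ Icc (0 : ℝ) 1, s' t = ‖p t‖ := fun t ht => IccExtend_of_mem _ _ ht
  set σ : ℝ → ℝ := fun t => ∫ x in (0 : ℝ)..t, s' x with hσ
  have hσd : ∀ t ∈ Icc (0 : ℝ) 1, HasDerivWithinAt σ ‖p t‖ (Icc 0 1) t := by
    intro t ht
    rw [← hs'e t ht]
    exact (hs'c.integral_hasStrictDerivAt 0 t).hasDerivAt.hasDerivWithinAt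
  obtain ⟨C, hC⟩ := isCompact_Icc.exists_bound_of_continuousOn
    (hqa.deriv.continuousOn.sub (hKc.mul hqa.continuousOn))
  refine ⟨g 1, n 0, σ 1, C + ‖q 1‖ + ‖q 0‖, fun k u hu0 hu => ?_⟩
  -- The explicit approximate solution: rotate about the fixed axis `n 0`, then carry that axis
  -- along by `g`. Its equation differs from that of `u` only by the bounded term `K`.
  set z : ℝ → ℍ[ℝ] := fun t => g t * (((Real.cos (k * σ t / 2) : ℝ) : ℍ[ℝ])
        - ((Real.sin (k * σ t / 2) : ℝ) : ℍ[ℝ]) * n 0) with hz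
  have hz0 : z 0 = 1 := by simp [hz, hσ, hg0]
  have hzd : ∀ t ∈ Icc (0 : ℝ) 1,
      HasDerivWithinAt z ((K t - (k / 2) • p t) * z t) (Icc 0 1) t := by
    intro t ht
    have hθ : HasDerivWithinAt (fun t => k * σ t / 2) (k * ‖p t‖ / 2) (Icc 0 1) t :=
      ((hσd t ht).const_mul k).div_const 2
    have hco : HasDerivWithinAt (fun t => ((Real.cos (k * σ t / 2) : ℝ) : ℍ[ℝ])) _ (Icc 0 1) t :=
      hasDerivWithinAt_coe hθ.cos
    have hsi : HasDerivWithinAt (fun t => ((Real.sin (k * σ t / 2) : ℝ) : ℍ[ℝ])) _ (Icc 0 1) t :=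
      hasDerivWithinAt_coe hθ.sin
    refine ((hg t ht).mul (hco.sub (hsi.mul_const (n 0)))).congr_deriv ?_
    have hpn : p t = ‖p t‖ • n t := by simp [hn, smul_smul, hs0 t ht]
    have h5 : n t * (g t * n 0) = -g t := by
      rw [hgn0 t ht, ← mul_assoc, hnn t ht, neg_one_mul]
    have hcoe : ∀ x : ℝ, (x : ℍ[ℝ]) = x • (1 : ℍ[ℝ]) := fun x => by
      rw [← Quaternion.coe_mul_eq_smul, mul_one]
    have halg : ∀ c s a : ℝ, K t * g t * ((c : ℍ[ℝ]) - (s : ℍ[ℝ]) * n 0)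
        + g t * (((-s * a : ℝ) : ℍ[ℝ]) - ((c * a : ℝ) : ℍ[ℝ]) * n 0)
        = (K t - a • n t) * (g t * ((c : ℍ[ℝ]) - (s : ℍ[ℝ]) * n 0)) := by
      intro c s a
      simp only [hcoe, smul_mul_assoc, one_mul, mul_sub, sub_mul, mul_smul_comm, mul_one,
        mul_assoc, h5]
      rw [← hgn0 t ht]
      module
    have h6 : (k / 2) • p t = (k * ‖p t‖ / 2) • n t := by
      conv_lhs => rw [hpn, smul_smul]
      congr 1
      ring
    rw [h6]
    exact halg _ _ _
  have hure : ∀ t ∈ Icc (0 : ℝ) 1, ((-(k / 2)) • p t).re = 0 := fun t _ => by simp [hre]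
  have hzre : ∀ t ∈ Icc (0 : ℝ) 1, (K t - (k / 2) • p t).re = 0 := fun t ht => by
    simp [hre, hKre t ht]
  have hun : ∀ t ∈ Icc (0 : ℝ) 1, ‖u t‖ = 1 := fun t ht => by
    rw [norm_eq_of_hasDerivWithinAt hure hu t ht, hu0, norm_one]
  have hzn : ∀ t ∈ Icc (0 : ℝ) 1, ‖z t‖ = 1 := fun t ht => by
    rw [norm_eq_of_hasDerivWithinAt hzre hzd t ht, hz0, norm_one]
  -- In this derivative the terms of order `k ^ 2` and `k` both cancel, so it is bounded uniformly
  -- in `k`. Integration then controls `k (u 1 - z 1)` up to the boundary terms `q 0` and `q 1`.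
  have hY : ∀ t ∈ Icc (0 : ℝ) 1, HasDerivWithinAt (fun t => star (z t) * (q t + k • 1) * u t)
      (star (z t) * (deriv q t - K t * q t) * u t) (Icc 0 1) t := by
    intro t ht
    refine (((hasDerivWithinAt_star (hzd t ht)).mul ((hqd t ht).hasDerivWithinAt.add_const _)).mul
      (hu t ht)).congr_deriv ?_
    rw [star_mul, star_eq_neg_of_re_eq_zero (hzre t ht)]
    have hpn : p t = ‖p t‖ • n t := by simp [hn, smul_smul, hs0 t ht]
    have h2 : -(K t - (k / 2) • p t) * (q t + k • 1) + (q t + k • 1) * ((-(k / 2)) • p t)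
        = - (K t * q t) := by
      have h3 : (k / 2) • (p t * q t) = (k / 4) • (n t * d t) := by
        conv_lhs => rw [hpn]
        simp only [hq, smul_mul_assoc, mul_smul_comm, smul_smul]
        congr 1
        field_simp [hs0 t ht]
        norm_num
      have h4 : (k / 2) • (q t * p t) = -((k / 4) • (n t * d t)) := by
        conv_lhs => rw [hpn]
        simp only [hq, smul_mul_assoc, mul_smul_comm, smul_smul]
        rw [hanti t ht, smul_neg]
        congr 2
        field_simp [hs0 t ht]
        norm_num
      simp only [neg_mul, sub_mul, mul_add, add_mul, smul_mul_assoc, mul_smul_comm, mul_one,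
        one_mul, neg_smul, mul_neg, smul_add]
      rw [h3, h4]
      simp only [hK]
      module
    calc _ = star (z t) * ((-(K t - (k / 2) • p t) * (q t + k • 1)
          + (q t + k • 1) * ((-(k / 2)) • p t)) + deriv q t) * u t := by
              simp only [Pi.mul_apply]; noncomm_ring
      _ = _ := by rw [h2]; noncomm_ring
  have h1 : (1 : ℝ) ∈ Icc (0 : ℝ) 1 := by simp
  have key := norm_image_sub_le_of_norm_deriv_le_segment_01' hY (C := C) (fun t ht => by
    have ht' := Ico_subset_Icc_self ht
    rw [norm_mul, norm_mul, _root_.norm_star, hun t ht', hzn t ht', one_mul, mul_one]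
    exact hC t ht')
  simp only [hu0, hz0, star_one, one_mul, mul_one] at key
  have h2 : k • (star (z 1) * (u 1 - z 1)) =
      (star (z 1) * (q 1 + k • 1) * u 1 - (q 0 + k • 1)) - star (z 1) * q 1 * u 1 + q 0 := by
    have : star (z 1) * z 1 = 1 := by
      rw [Quaternion.star_mul_self, normSq_eq_norm_mul_self, hzn 1 h1]
      simp
    rw [mul_sub, this]
    simp only [mul_add, add_mul, mul_smul_comm, smul_mul_assoc, mul_one]
    module
  have h3 : |k| * ‖u 1 - z 1‖ = ‖k • (star (z 1) * (u 1 - z 1))‖ := by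
    rw [norm_smul, norm_mul, _root_.norm_star, hzn 1 h1, one_mul, Real.norm_eq_abs]
  show |k| * ‖u 1 - z 1‖ ≤ _
  rw [h3, h2]
  refine (norm_add_le _ _).trans (add_le_add ((norm_sub_le _ _).trans (add_le_add key ?_)) le_rfl)
  rw [norm_mul, norm_mul, _root_.norm_star, hun 1 h1, hzn 1 h1, one_mul, mul_one]

end LQC

end

noncomputable section

namespace LQC

open Quaternion Set

/-! ### Holonomies of homogeneous isotropic connections in terms of quaternions -/

/-- The representation of the quaternions by `2 × 2` matrices which sends the units `i`, `j`, `k`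
to `2 τ_1`, `2 τ_2`, `2 τ_3`. -/
def quaternionMatrix (q : ℍ[ℝ]) : Matrix (Fin 2) (Fin 2) ℂ :=
  !![⟨q.re, -q.imK⟩, ⟨-q.imJ, -q.imI⟩; ⟨q.imJ, -q.imI⟩, ⟨q.re, q.imK⟩]

theorem quaternionMatrix_mul (p q : ℍ[ℝ]) :
    quaternionMatrix (p * q) = quaternionMatrix p * quaternionMatrix q := by
  ext i j
  fin_cases i <;> fin_cases j <;>
    simp [quaternionMatrix, Matrix.mul_apply, Complex.ext_iff] <;> constructor <;> ring

theorem quaternionMatrix_one : quaternionMatrix 1 = 1 := by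
  ext i j
  fin_cases i <;> fin_cases j <;> simp [quaternionMatrix, Complex.ext_iff]

theorem quaternionMatrix_mem {q : ℍ[ℝ]} (h : ‖q‖ = 1) :
    quaternionMatrix q ∈ Matrix.specialUnitaryGroup (Fin 2) ℂ := by
  have h1 : q.re ^ 2 + q.imI ^ 2 + q.imJ ^ 2 + q.imK ^ 2 = 1 := by
    rw [← Quaternion.normSq_def', normSq_eq_norm_mul_self, h, one_mul]
  rw [Matrix.mem_specialUnitaryGroup_iff, Matrix.mem_unitaryGroup_iff]
  constructor
  · ext i j
    fin_cases i <;> fin_cases j <;>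
      simp [quaternionMatrix, Matrix.mul_apply, Complex.ext_iff] <;> constructor <;>
      first | linear_combination h1 | linear_combination (0 : ℝ) * h1
  · simp [quaternionMatrix, Matrix.det_fin_two, Complex.ext_iff]
    constructor <;> first | linear_combination h1 | linear_combination (0 : ℝ) * h1

theorem quaternionMatrix_neg (q : ℍ[ℝ]) : quaternionMatrix (-q) = -quaternionMatrix q := by
  ext i j
  fin_cases i <;> fin_cases j <;> simp [quaternionMatrix, Complex.ext_iff]

/-- The quaternion of norm one that represents an element of `SU(2)`. -/
def unitQuaternion (U : Matrix (Fin 2) (Fin 2) ℂ) : ℍ[ℝ] :=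
  ⟨(U 0 0).re, -(U 1 0).im, (U 1 0).re, -(U 0 0).im⟩

/-- For a unitary matrix of determinant one, the conjugate transpose is the adjugate, so the first
column determines the second. -/
theorem quaternionMatrix_unitQuaternion (U : SU2) :
    quaternionMatrix (unitQuaternion U) = (U : Matrix (Fin 2) (Fin 2) ℂ) := by
  obtain ⟨U, hU⟩ := U
  obtain ⟨h1, h2⟩ := Matrix.mem_specialUnitaryGroup_iff.1 hU
  have h3 : star U = U.adjugate := by
    have h4 := Matrix.mem_unitaryGroup_iff'.1 h1
    calc star U = star U * (U * U.adjugate) := by rw [Matrix.mul_adjugate, h2]; simp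
      _ = U.adjugate := by rw [← mul_assoc, h4, one_mul]
  rw [Matrix.adjugate_fin_two] at h3
  have h5 := congrFun (congrFun h3 0) 0
  have h6 := congrFun (congrFun h3 0) 1
  simp [Matrix.star_apply, Complex.ext_iff] at h5 h6
  have h7 : -(U 1 1).im = (U 0 0).im := by linarith [h5.2]
  ext i j
  fin_cases i <;> fin_cases j <;>
    simp [quaternionMatrix, unitQuaternion, Complex.ext_iff, h5, h6, h7]

/-- A vector of `ℝ³` as an imaginary quaternion. -/
def imaginary (v : Space) : ℍ[ℝ] := ⟨0, v 0, v 1, v 2⟩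

@[simp] theorem imaginary_re (v : Space) : (imaginary v).re = 0 := rfl
@[simp] theorem imaginary_imI (v : Space) : (imaginary v).imI = v 0 := rfl
@[simp] theorem imaginary_imJ (v : Space) : (imaginary v).imJ = v 1 := rfl
@[simp] theorem imaginary_imK (v : Space) : (imaginary v).imK = v 2 := rfl

theorem smul_imaginary_re (k : ℝ) (v : Space) : (k • imaginary v).re = 0 := by simp

theorem hasDerivWithinAt_quaternion {f : ℝ → ℍ[ℝ]} {f' : ℍ[ℝ]} {s : Set ℝ} {t : ℝ}
    (h₀ : HasDerivWithinAt (fun x => (f x).re) f'.re s t)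
    (h₁ : HasDerivWithinAt (fun x => (f x).imI) f'.imI s t)
    (h₂ : HasDerivWithinAt (fun x => (f x).imJ) f'.imJ s t)
    (h₃ : HasDerivWithinAt (fun x => (f x).imK) f'.imK s t) : HasDerivWithinAt f f' s t := by
  have key : ∀ q : ℍ[ℝ], q = q.re • (1 : ℍ[ℝ]) + q.imI • imaginary ![1, 0, 0]
      + q.imJ • imaginary ![0, 1, 0] + q.imK • imaginary ![0, 0, 1] := by
    intro q
    ext <;> simp
  rw [key f', funext fun x => key (f x)]
  exact (((h₀.smul_const _).add (h₁.smul_const _)).add (h₂.smul_const _)).add (h₃.smul_const _)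

theorem hasDerivWithinAt_quaternionMatrix {f : ℝ → ℍ[ℝ]} {f' : ℍ[ℝ]} {s : Set ℝ} {t : ℝ}
    (h : HasDerivWithinAt f f' s t) (i j : Fin 2) :
    HasDerivWithinAt (fun x => quaternionMatrix (f x) i j) (quaternionMatrix f' i j) s t :=
  (LinearMap.toContinuousLinearMap
    ({ toFun := fun q => quaternionMatrix q i j
       map_add' := fun p q => by
        fin_cases i <;> fin_cases j <;> simp [quaternionMatrix, Complex.ext_iff] <;> ring_nf <;> simp
       map_smul' := fun r q => by
        fin_cases i <;> fin_cases j <;> simp [quaternionMatrix, Complex.ext_iff] } :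
      ℍ[ℝ] →ₗ[ℝ] ℂ)).hasFDerivAt.comp_hasDerivWithinAt t h

/-- The homogeneous isotropic connection with components `k δ^i_a`. -/
def Connection.IsIsotropic (A : Connection) (k : ℝ) : Prop :=
  ∀ x a i, A.coeff x a i = if a = i then k else 0

theorem Connection.IsIsotropic.eval {A : Connection} {k : ℝ} (h : A.IsIsotropic k)
    (x v : Space) : A.eval x v = quaternionMatrix ((k / 2) • imaginary v) := by
  unfold Connection.eval
  ext i j
  fin_cases i <;> fin_cases j <;>
    simp [h x, Fin.sum_univ_three, tau, pauli, quaternionMatrix, Complex.ext_iff] <;>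
    (try constructor) <;> ring_nf

/-- The equation of parallel transport along an arc, for quaternions. -/
def IsQuaternionTransport (k : ℝ) (e : AnalyticArc) (u : ℝ → ℍ[ℝ]) : Prop :=
  u 0 = 1 ∧ ∀ t ∈ Icc (0 : ℝ) 1,
    HasDerivWithinAt u ((-(k / 2)) • imaginary (deriv e.toFun t) * u t) (Icc 0 1) t

/-! ### Parallel transport along an arc: existence, uniqueness and dependence on `k` -/

theorem AnalyticArc.analyticOnNhd_imaginary (e : AnalyticArc) :
    AnalyticOnNhd ℝ (fun t => imaginary (deriv e.toFun t)) (Icc 0 1) := by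
  let L : Space →ₗ[ℝ] ℍ[ℝ] :=
    { toFun := imaginary
      map_add' := fun v w => by ext <;> simp
      map_smul' := fun r v => by ext <;> simp }
  intro t ht
  exact (LinearMap.toContinuousLinearMap L).analyticAt _ |>.comp (e.analytic.deriv t ht)

theorem AnalyticArc.imaginary_ne_zero (e : AnalyticArc) {t : ℝ} (ht : t ∈ Icc (0 : ℝ) 1) :
    imaginary (deriv e.toFun t) ≠ 0 := by
  intro h
  apply e.regular t ht
  have h1 := congrArg QuaternionAlgebra.imI h
  have h2 := congrArg QuaternionAlgebra.imJ h
  have h3 := congrArg QuaternionAlgebra.imK h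
  simp only [imaginary_imI, imaginary_imJ, imaginary_imK] at h1 h2 h3
  ext i
  fin_cases i
  exacts [h1, h2, h3]

theorem IsQuaternionTransport.norm_eq_one {k : ℝ} {e : AnalyticArc} {u : ℝ → ℍ[ℝ]}
    (h : IsQuaternionTransport k e u) {t : ℝ} (ht : t ∈ Icc (0 : ℝ) 1) : ‖u t‖ = 1 := by
  rw [norm_eq_of_hasDerivWithinAt (fun _ _ => smul_imaginary_re _ _) h.2 t ht, h.1, norm_one]

theorem IsQuaternionTransport.norm_sub_le {k k' C : ℝ} {e : AnalyticArc} {u v : ℝ → ℍ[ℝ]}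
    (hu : IsQuaternionTransport k e u) (hv : IsQuaternionTransport k' e v)
    (hC : ∀ t ∈ Icc (0 : ℝ) 1, ‖imaginary (deriv e.toFun t)‖ ≤ C) :
    ‖u 1 - v 1‖ ≤ |k - k'| / 2 * C := by
  refine norm_sub_le_of_hasDerivWithinAt (fun _ _ => smul_imaginary_re _ _)
    (fun _ _ => smul_imaginary_re _ _) (fun t ht => ?_) hu.1 hv.1 hu.2 hv.2
  rw [← sub_smul, norm_smul, Real.norm_eq_abs,
    show -(k / 2) - -(k' / 2) = -((k - k') / 2) by ring, abs_neg, abs_div, abs_two]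
  exact mul_le_mul_of_nonneg_left (hC t ht) (by positivity)

theorem exists_isQuaternionTransport (k : ℝ) (e : AnalyticArc) :
    ∃ u, IsQuaternionTransport k e u :=
  exists_quaternion_solution (fun _ _ => smul_imaginary_re _ _)
    (e.analyticOnNhd_imaginary.continuousOn.const_smul (-(k / 2)))

theorem AnalyticArc.exists_norm_imaginary_le (e : AnalyticArc) :
    ∃ C, ∀ t ∈ Icc (0 : ℝ) 1, ‖imaginary (deriv e.toFun t)‖ ≤ C :=
  isCompact_Icc.exists_bound_of_continuousOn e.analyticOnNhd_imaginary.continuousOn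

theorem IsQuaternionTransport.eq {k : ℝ} {e : AnalyticArc} {u v : ℝ → ℍ[ℝ]}
    (hu : IsQuaternionTransport k e u) (hv : IsQuaternionTransport k e v) : u 1 = v 1 := by
  obtain ⟨C, hC⟩ := e.exists_norm_imaginary_le
  simpa [sub_eq_zero] using hu.norm_sub_le hv hC

theorem IsParallelTransport.isQuaternionTransport {A : Connection} {k : ℝ}
    (h : A.IsIsotropic k) {e : AnalyticArc} {U : ℝ → SU2} (hU : IsParallelTransport A e U) :
    IsQuaternionTransport k e fun t => unitQuaternion (U t) := by
  constructor
  · simp only [hU.1]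
    ext <;> simp [unitQuaternion]
  · intro t ht
    have h1 : ∀ i j : Fin 2, (-(A.eval (e.toFun t) (deriv e.toFun t)) * (U t).1) i j =
        quaternionMatrix ((-(k / 2)) • imaginary (deriv e.toFun t) * unitQuaternion (U t)) i j := by
      intro i j
      rw [quaternionMatrix_mul, quaternionMatrix_unitQuaternion, h.eval, neg_smul,
        quaternionMatrix_neg]
    have hre : ∀ i j, HasDerivWithinAt (fun s => ((U s).1 i j).re) _ (Icc 0 1) t := fun i j =>
      Complex.reCLM.hasFDerivAt.comp_hasDerivWithinAt t (hU.2 t ht i j)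
    have him : ∀ i j, HasDerivWithinAt (fun s => ((U s).1 i j).im) _ (Icc 0 1) t := fun i j =>
      Complex.imCLM.hasFDerivAt.comp_hasDerivWithinAt t (hU.2 t ht i j)
    refine hasDerivWithinAt_quaternion ?_ ?_ ?_ ?_
    · exact (hre 0 0).congr_deriv (by rw [h1]; rfl)
    · exact (him 1 0).neg.congr_deriv (by rw [h1]; exact neg_neg _)
    · exact (hre 1 0).congr_deriv (by rw [h1]; rfl)
    · exact (him 0 0).neg.congr_deriv (by rw [h1]; exact neg_neg _)

theorem IsQuaternionTransport.exists_isParallelTransport {A : Connection} {k : ℝ}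
    (h : A.IsIsotropic k) {e : AnalyticArc} {u : ℝ → ℍ[ℝ]} (hu : IsQuaternionTransport k e u) :
    ∃ U, IsParallelTransport A e U := by
  classical
  -- A parallel transport has values in `SU2` at every real time, but `u` is known to be a unit only
  -- on `[0, 1]`; elsewhere the value `1` is substituted.
  have hmem : ∀ t, quaternionMatrix (if ‖u t‖ = 1 then u t else 1) ∈
      Matrix.specialUnitaryGroup (Fin 2) ℂ := by
    intro t
    split_ifs with ht
    · exact quaternionMatrix_mem ht
    · exact quaternionMatrix_mem norm_one
  have heq : ∀ t ∈ Icc (0 : ℝ) 1, (if ‖u t‖ = 1 then u t else 1) = u t := fun t ht =>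
    if_pos (hu.norm_eq_one ht)
  refine ⟨fun t => ⟨_, hmem t⟩, ?_, fun t ht i j => ?_⟩
  · ext1
    show quaternionMatrix _ = 1
    rw [heq 0 (by simp), hu.1, quaternionMatrix_one]
  · refine ((hasDerivWithinAt_quaternionMatrix (hu.2 t ht) i j).congr (fun s hs => ?_)
      ?_).congr_deriv ?_
    · show quaternionMatrix _ i j = _
      rw [heq s hs]
    · show quaternionMatrix _ i j = _
      rw [heq t ht]
    · show _ = (_ * quaternionMatrix (if ‖u t‖ = 1 then u t else 1) : Matrix _ _ ℂ) i j
      rw [heq t ht, quaternionMatrix_mul, h.eval, neg_smul,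
        quaternionMatrix_neg]

/-- Uniqueness of the quaternion transport at time `1` makes the choice in `arcHolonomy` immaterial.
-/
theorem IsQuaternionTransport.arcHolonomy_eq {A : Connection} {k : ℝ}
    (h : A.IsIsotropic k) {e : AnalyticArc} {u : ℝ → ℍ[ℝ]} (hu : IsQuaternionTransport k e u) :
    (arcHolonomy A e : Matrix (Fin 2) (Fin 2) ℂ) = quaternionMatrix (u 1) := by
  have hex := hu.exists_isParallelTransport h
  rw [arcHolonomy, dif_pos hex, hu.eq (hex.choose_spec.isQuaternionTransport h),
    quaternionMatrix_unitQuaternion]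

/-- The quaternion that represents the holonomy of the connection `k δ^i_a` along an arc. -/
def quaternionHolonomy (e : AnalyticArc) (k : ℝ) : ℍ[ℝ] :=
  (exists_isQuaternionTransport k e).choose 1

theorem arcHolonomy_eq_quaternionHolonomy {A : Connection} {k : ℝ} (h : A.IsIsotropic k)
    (e : AnalyticArc) : (arcHolonomy A e : Matrix (Fin 2) (Fin 2) ℂ) =
      quaternionMatrix (quaternionHolonomy e k) :=
  (exists_isQuaternionTransport k e).choose_spec.arcHolonomy_eq h

theorem continuous_quaternionHolonomy (e : AnalyticArc) : Continuous (quaternionHolonomy e) := by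
  obtain ⟨C, hC⟩ := e.exists_norm_imaginary_le
  have hC0 : 0 ≤ C := (norm_nonneg _).trans (hC 0 (by simp))
  refine (LipschitzWith.of_dist_le_mul (K := (C / 2).toNNReal) fun k k' => ?_).continuous
  rw [dist_eq_norm, Real.coe_toNNReal _ (by positivity), Real.dist_eq]
  have := (exists_isQuaternionTransport k e).choose_spec.norm_sub_le
    (exists_isQuaternionTransport k' e).choose_spec hC
  unfold quaternionHolonomy
  linarith

theorem exists_quaternionHolonomy_asymptotics (e : AnalyticArc) :
    ∃ (g₁ n₀ : ℍ[ℝ]) (L C : ℝ), ∀ k : ℝ,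
      |k| * ‖quaternionHolonomy e k - g₁ * (((Real.cos (k * L / 2) : ℝ) : ℍ[ℝ])
        - ((Real.sin (k * L / 2) : ℝ) : ℍ[ℝ]) * n₀)‖ ≤ C := by
  obtain ⟨g₁, n₀, L, C, h⟩ := exists_norm_sub_le_of_rapidly_rotating e.analyticOnNhd_imaginary
    (fun _ => rfl) (fun _ ht => e.imaginary_ne_zero ht)
  exact ⟨g₁, n₀, L, C, fun k => h k _ (exists_isQuaternionTransport k e).choose_spec.1
    (exists_isQuaternionTransport k e).choose_spec.2⟩

/-! ### Connections invariant under the Euclidean group -/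

theorem Connection.IsIsotropic.ray {A : Connection} {k : ℝ} (h : A.IsIsotropic k) (c : ℝ) :
    (ray A c).IsIsotropic (c * k) := by
  intro x a i
  simp [LQC.ray, h x a i]

/-- Translations make the components constant. The half-turns `R₁` and `R₂` about the first and
third axes kill the off-diagonal ones, and the cyclic permutation `R₃` of the axes equates the
diagonal ones. -/
theorem Connection.IsEuclideanInvariant.exists_isIsotropic {A : Connection}
    (h : A.IsEuclideanInvariant) : ∃ k, A.IsIsotropic k := by
  have hconst : ∀ x a i, A.coeff x a i = A.coeff 0 a i := by
    intro x a i
    have := h 1 x 0 a i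
    simpa [Matrix.one_apply, eq_comm] using this
  have hR : ∀ (R : Matrix.specialOrthogonalGroup (Fin 3) ℝ) (a i : Fin 3),
      ∑ b, ∑ j, R.1 a b * R.1 i j * A.coeff 0 b j = A.coeff 0 a i := by
    intro R a i
    rw [h R 0 0 a i, hconst]
  let R₁ : Matrix.specialOrthogonalGroup (Fin 3) ℝ := ⟨!![1, 0, 0; 0, -1, 0; 0, 0, -1], by
    rw [Matrix.mem_specialOrthogonalGroup_iff, Matrix.mem_orthogonalGroup_iff]
    constructor
    · ext i j; fin_cases i <;> fin_cases j <;> simp [Matrix.mul_apply, Fin.sum_univ_three]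
    · simp [Matrix.det_fin_three]⟩
  let R₂ : Matrix.specialOrthogonalGroup (Fin 3) ℝ := ⟨!![-1, 0, 0; 0, -1, 0; 0, 0, 1], by
    rw [Matrix.mem_specialOrthogonalGroup_iff, Matrix.mem_orthogonalGroup_iff]
    constructor
    · ext i j; fin_cases i <;> fin_cases j <;> simp [Matrix.mul_apply, Fin.sum_univ_three]
    · simp [Matrix.det_fin_three]⟩
  let R₃ : Matrix.specialOrthogonalGroup (Fin 3) ℝ := ⟨!![0, 1, 0; 0, 0, 1; 1, 0, 0], by
    rw [Matrix.mem_specialOrthogonalGroup_iff, Matrix.mem_orthogonalGroup_iff]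
    constructor
    · ext i j; fin_cases i <;> fin_cases j <;> simp [Matrix.mul_apply, Fin.sum_univ_three]
    · simp [Matrix.det_fin_three]⟩
  have e1 := fun a i => hR R₁ a i
  have e2 := fun a i => hR R₂ a i
  have e3 := fun a i => hR R₃ a i
  simp only [Fin.forall_fin_succ, Fin.sum_univ_three, R₁, R₂, R₃] at e1 e2 e3
  simp at e1 e2 e3
  refine ⟨A.coeff 0 0 0, fun x a i => ?_⟩
  rw [hconst]
  fin_cases a <;> fin_cases i <;> simp <;> linarith

end LQC

end

noncomputable section

namespace LQC

open Filter Topology Quaternion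

/-! ### Uniform closures -/

theorem le_uniformClosure {X : Type*} (S : Submodule ℂ (X → ℂ)) : S ≤ uniformClosure S :=
  fun f hf ε hε => ⟨f, hf, fun x => by simpa using hε.le⟩

theorem uniformClosure_mono {X : Type*} {S T : Submodule ℂ (X → ℂ)} (h : S ≤ T) :
    uniformClosure S ≤ uniformClosure T := fun _ hf ε hε =>
  let ⟨g, hg, hfg⟩ := hf ε hε
  ⟨g, h hg, hfg⟩

theorem uniformClosure_uniformClosure_le {X : Type*} (S : Submodule ℂ (X → ℂ)) :
    uniformClosure (uniformClosure S) ≤ uniformClosure S := by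
  intro f hf ε hε
  obtain ⟨g, hg, hfg⟩ := hf (ε / 2) (by positivity)
  obtain ⟨k, hk, hgk⟩ := hg (ε / 2) (by positivity)
  refine ⟨k, hk, fun x => ?_⟩
  have := norm_sub_le_norm_sub_add_norm_sub (f x) (g x) (k x)
  linarith [hfg x, hgk x]

theorem uniformClosure_vanishingAtInfinity_le :
    uniformClosure VanishingAtInfinity ≤ VanishingAtInfinity := by
  intro f hf
  constructor
  · refine continuous_of_uniform_approx_of_continuous fun u hu => ?_
    obtain ⟨ε, hε, hu⟩ := Metric.mem_uniformity_dist.1 hu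
    obtain ⟨g, hg, hfg⟩ := hf (ε / 2) (by positivity)
    refine ⟨g, hg.1, fun x => hu ?_⟩
    rw [dist_eq_norm]
    linarith [hfg x]
  · rw [Metric.tendsto_nhds]
    intro ε hε
    obtain ⟨g, hg, hfg⟩ := hf (ε / 2) (by positivity)
    filter_upwards [Metric.tendsto_nhds.1 hg.2 (ε / 2) (by positivity)] with x hx
    rw [dist_zero_right] at hx ⊢
    have := norm_sub_le_norm_sub_add_norm_sub (f x) (g x) 0
    rw [sub_zero, sub_zero] at this
    linarith [hfg x]

/-! ### Trigonometric polynomials and almost periodic functions -/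

/-- The linear combinations of the exponentials `c ↦ e^{iμc}`. -/
def TrigPolynomial : Submodule ℂ (ℝ → ℂ) :=
  Submodule.span ℂ (Set.range fun (μ c : ℝ) => Complex.exp (Complex.I * (μ : ℂ) * (c : ℂ)))

theorem exp_mem_trigPolynomial (μ : ℝ) :
    (fun c : ℝ => Complex.exp (Complex.I * (μ : ℂ) * (c : ℂ))) ∈ TrigPolynomial :=
  Submodule.subset_span ⟨μ, rfl⟩

theorem norm_exp_I_mul_mul (μ c : ℝ) : ‖Complex.exp (Complex.I * (μ : ℂ) * (c : ℂ))‖ = 1 := by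
  rw [show Complex.I * (μ : ℂ) * (c : ℂ) = ((μ * c : ℝ) : ℂ) * Complex.I by push_cast; ring]
  exact Complex.norm_exp_ofReal_mul_I _

theorem const_mem_trigPolynomial (z : ℂ) : (fun _ : ℝ => z) ∈ TrigPolynomial := by
  have := TrigPolynomial.smul_mem z (exp_mem_trigPolynomial 0)
  convert this using 1
  ext c
  simp

theorem TrigPolynomial.continuous {a : ℝ → ℂ} (ha : a ∈ TrigPolynomial) : Continuous a := by
  induction ha using Submodule.span_induction with
  | mem f hf => obtain ⟨μ, rfl⟩ := hf; fun_prop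
  | zero => exact continuous_const
  | add f g _ _ hf hg => exact hf.add hg
  | smul z f _ hf => exact hf.const_smul z

theorem TrigPolynomial.exists_bound {a : ℝ → ℂ} (ha : a ∈ TrigPolynomial) :
    ∃ C, ∀ c, ‖a c‖ ≤ C := by
  induction ha using Submodule.span_induction with
  | mem f hf => obtain ⟨μ, rfl⟩ := hf; exact ⟨1, fun c => (norm_exp_I_mul_mul μ c).le⟩
  | zero => exact ⟨0, by simp⟩
  | add f g _ _ hf hg =>
    obtain ⟨C, hC⟩ := hf
    obtain ⟨D, hD⟩ := hg
    exact ⟨C + D, fun c => (norm_add_le _ _).trans (add_le_add (hC c) (hD c))⟩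
  | smul z f _ hf =>
    obtain ⟨C, hC⟩ := hf
    refine ⟨‖z‖ * C, fun c => ?_⟩
    rw [Pi.smul_apply, norm_smul]
    exact mul_le_mul_of_nonneg_left (hC c) (norm_nonneg _)

theorem TrigPolynomial.star_mem {a : ℝ → ℂ} (ha : a ∈ TrigPolynomial) :
    star a ∈ TrigPolynomial := by
  induction ha using Submodule.span_induction with
  | mem f hf =>
    obtain ⟨μ, rfl⟩ := hf
    convert exp_mem_trigPolynomial (-μ) using 1
    ext c
    simp [← Complex.exp_conj]
  | zero => simp
  | add f g _ _ hf hg => rw [star_add]; exact Submodule.add_mem _ hf hg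
  | smul z f _ hf => rw [StarModule.star_smul]; exact Submodule.smul_mem _ _ hf

theorem TrigPolynomial.mul_mem {a b : ℝ → ℂ} (ha : a ∈ TrigPolynomial)
    (hb : b ∈ TrigPolynomial) : a * b ∈ TrigPolynomial := by
  induction ha using Submodule.span_induction with
  | mem f hf =>
    obtain ⟨μ, rfl⟩ := hf
    induction hb using Submodule.span_induction with
    | mem g hg =>
      obtain ⟨ν, rfl⟩ := hg
      convert exp_mem_trigPolynomial (μ + ν) using 1
      ext c
      simp only [Pi.mul_apply, ← Complex.exp_add]
      congr 1
      push_cast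
      ring
    | zero => simp
    | add f g _ _ hf hg => rw [mul_add]; exact Submodule.add_mem _ hf hg
    | smul z f _ hf => rw [mul_smul_comm]; exact Submodule.smul_mem _ _ hf
  | zero => simp
  | add f g _ _ hf hg => rw [add_mul]; exact Submodule.add_mem _ hf hg
  | smul z f _ hf => rw [smul_mul_assoc]; exact Submodule.smul_mem _ _ hf

theorem cos_mem_trigPolynomial (L : ℝ) :
    (fun c : ℝ => ((Real.cos (c * L) : ℝ) : ℂ)) ∈ TrigPolynomial := by
  have := TrigPolynomial.smul_mem (1 / 2)
    (TrigPolynomial.add_mem (exp_mem_trigPolynomial L) (exp_mem_trigPolynomial (-L)))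
  convert this using 1
  ext c
  simp only [Pi.smul_apply, Pi.add_apply, smul_eq_mul, Complex.ofReal_cos, Complex.cos]
  rw [show ((c * L : ℝ) : ℂ) * Complex.I = Complex.I * L * c by push_cast; ring,
    show -((c * L : ℝ) : ℂ) * Complex.I = Complex.I * (-L : ℝ) * c by push_cast; ring]
  ring

theorem sin_mem_trigPolynomial (L : ℝ) :
    (fun c : ℝ => ((Real.sin (c * L) : ℝ) : ℂ)) ∈ TrigPolynomial := by
  have := TrigPolynomial.smul_mem (Complex.I / 2)
    (TrigPolynomial.sub_mem (exp_mem_trigPolynomial (-L)) (exp_mem_trigPolynomial L))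
  convert this using 1
  ext c
  simp only [Pi.smul_apply, Pi.sub_apply, smul_eq_mul, Complex.ofReal_sin, Complex.sin]
  rw [show ((c * L : ℝ) : ℂ) * Complex.I = Complex.I * L * c by push_cast; ring,
    show -((c * L : ℝ) : ℂ) * Complex.I = Complex.I * (-L : ℝ) * c by push_cast; ring]
  ring

/-- Trigonometric polynomials recur: the double limit of `a (x + t - t')` is `a x`. -/
theorem TrigPolynomial.exists_limit {a : ℝ → ℂ} (ha : a ∈ TrigPolynomial) :
    ∃ a' : ℝ → ℂ,
      (∀ x, Tendsto (fun t => a (x + t)) (Ultrafilter.of (atTop : Filter ℝ)) (𝓝 (a' x))) ∧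
      ∀ x, Tendsto (fun t => a' (x - t)) (Ultrafilter.of (atTop : Filter ℝ)) (𝓝 (a x)) := by
  induction ha using Submodule.span_induction with
  | mem f hf =>
    obtain ⟨μ, rfl⟩ := hf
    -- Along the ultrafilter `e^{iμt}` converges to some `ξ` on the unit circle. The forward limit
    -- multiplies by `ξ`, the backward one by `ξ⁻¹`. A single ultrafilter serves all frequencies, so
    -- linear combinations cause no difficulty.
    obtain ⟨ξ, hξ, hlim⟩ := (isCompact_sphere (0 : ℂ) 1).ultrafilter_le_nhds
      ((Ultrafilter.of (atTop : Filter ℝ)).map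
        fun t : ℝ => Complex.exp (Complex.I * (μ : ℂ) * (t : ℂ)))
      (by
        rw [le_principal_iff, Ultrafilter.coe_map]
        exact Filter.mem_map.2 (Filter.univ_mem' fun t =>
          mem_sphere_zero_iff_norm.2 (norm_exp_I_mul_mul μ t)))
    rw [Ultrafilter.coe_map] at hlim
    have hlim' : Tendsto (fun t : ℝ => Complex.exp (Complex.I * (μ : ℂ) * (t : ℂ)))
      (Ultrafilter.of (atTop : Filter ℝ)) (𝓝 ξ) := hlim
    have hξ1 : ‖ξ‖ = 1 := by simpa using hξ
    have hξ0 : ξ ≠ 0 := norm_ne_zero_iff.1 (by rw [hξ1]; exact one_ne_zero)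
    refine ⟨fun x => Complex.exp (Complex.I * (μ : ℂ) * (x : ℂ)) * ξ, fun x => ?_, fun x => ?_⟩
    · refine (hlim'.const_mul _).congr fun t => ?_
      rw [← Complex.exp_add]
      congr 1
      push_cast
      ring
    · have := ((hlim'.inv₀ hξ0).const_mul
        (Complex.exp (Complex.I * (μ : ℂ) * (x : ℂ)))).mul_const ξ
      rw [inv_mul_cancel_right₀ hξ0] at this
      refine this.congr fun t => ?_
      rw [← Complex.exp_neg, ← Complex.exp_add]
      congr 2
      push_cast
      ring
  | zero => exact ⟨0, fun x => tendsto_const_nhds, fun x => tendsto_const_nhds⟩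
  | add f g _ _ hf hg =>
    obtain ⟨f', hf1, hf2⟩ := hf
    obtain ⟨g', hg1, hg2⟩ := hg
    exact ⟨f' + g', fun x => (hf1 x).add (hg1 x), fun x => (hf2 x).add (hg2 x)⟩
  | smul z f _ hf =>
    obtain ⟨f', hf1, hf2⟩ := hf
    exact ⟨z • f', fun x => (hf1 x).const_smul z, fun x => (hf2 x).const_smul z⟩

/-- Translating to infinity removes `v` and leaves the bound on the translated limit `a'`;
translating back recovers `a` with the same bound. -/
theorem TrigPolynomial.norm_le_of_norm_add_le {a v : ℝ → ℂ} {ε : ℝ} (ha : a ∈ TrigPolynomial)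
    (hv : v ∈ VanishingAtInfinity) (h : ∀ x, ‖a x + v x‖ ≤ ε) (x : ℝ) : ‖a x‖ ≤ ε := by
  obtain ⟨a', h1, h2⟩ := TrigPolynomial.exists_limit ha
  have h3 : ∀ y, ‖a' y‖ ≤ ε := by
    intro y
    have hv' : Tendsto (fun t => v (y + t)) (Ultrafilter.of (atTop : Filter ℝ)) (𝓝 0) :=
      (hv.2.comp ((tendsto_atTop_add_const_left atTop y tendsto_id).mono_right
        atTop_le_cocompact)).mono_left (Ultrafilter.of_le _)
    have h4 := (h1 y).add hv'
    rw [add_zero] at h4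
    exact le_of_tendsto h4.norm (Eventually.of_forall fun t => h _)
  exact le_of_tendsto (h2 x).norm (Eventually.of_forall fun t => h3 _)

/-- This says that the projection onto the almost periodic part is a contraction for the sup norm.
Both the directness and the closedness of the sum follow from it. -/
theorem CylS.norm_le_of_norm_add_le {a v : ℝ → ℂ} {ε : ℝ} (ha : a ∈ CylS)
    (hv : v ∈ VanishingAtInfinity) (h : ∀ x, ‖a x + v x‖ ≤ ε) (x : ℝ) : ‖a x‖ ≤ ε := by
  refine le_of_forall_pos_le_add fun δ hδ => ?_
  obtain ⟨b, hb, hab⟩ := ha (δ / 2) (by positivity)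
  have h1 := TrigPolynomial.norm_le_of_norm_add_le (ε := ε + δ / 2) hb hv (fun y => ?_) x
  · have := norm_sub_le_norm_sub_add_norm_sub (a x) (b x) 0
    rw [sub_zero, sub_zero] at this
    linarith [hab x]
  · have h2 : b y + v y = (a y + v y) - (a y - b y) := by ring
    rw [h2]
    exact (norm_sub_le _ _).trans (add_le_add (h y) (hab y))

theorem disjoint_cylS_vanishingAtInfinity : Disjoint CylS VanishingAtInfinity := by
  rw [Submodule.disjoint_def]
  intro a ha hv
  ext x
  have := CylS.norm_le_of_norm_add_le (ε := 0) ha (VanishingAtInfinity.neg_mem hv) (by simp) x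
  simpa using this

theorem uniformClosure_sup_le :
    uniformClosure (CylS ⊔ VanishingAtInfinity) ≤ CylS ⊔ VanishingAtInfinity := by
  intro f hf
  have h1 : ∀ n : ℕ, ∃ a ∈ CylS, ∃ v ∈ VanishingAtInfinity,
      ∀ x, ‖f x - (a x + v x)‖ ≤ 1 / ((n : ℝ) + 1) := by
    intro n
    obtain ⟨g, hg, hfg⟩ := hf (1 / ((n : ℝ) + 1)) (by positivity)
    obtain ⟨a, ha, v, hv, rfl⟩ := Submodule.mem_sup.1 hg
    exact ⟨a, ha, v, hv, hfg⟩
  choose a ha v hv hav using h1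
  -- Contractivity transfers the Cauchy property from the approximants of `f` to their almost
  -- periodic parts.
  have hdist : ∀ m n x, ‖a m x - a n x‖ ≤ 1 / ((m : ℝ) + 1) + 1 / ((n : ℝ) + 1) := by
    intro m n
    refine CylS.norm_le_of_norm_add_le (CylS.sub_mem (ha m) (ha n))
      (VanishingAtInfinity.sub_mem (hv m) (hv n)) fun x => ?_
    have h2 : (a m x - a n x) + (v m x - v n x) =
        (f x - (a n x + v n x)) - (f x - (a m x + v m x)) := by ring
    show ‖(a m x - a n x) + (v m x - v n x)‖ ≤ _
    rw [h2]
    exact (norm_sub_le _ _).trans (by linarith [hav m x, hav n x])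
  have hlim0 : Tendsto (fun n : ℕ => 1 / ((n : ℝ) + 1)) atTop (𝓝 0) :=
    tendsto_one_div_add_atTop_nhds_zero_nat
  have hcauchy : ∀ x, CauchySeq fun n => a n x := by
    intro x
    rw [Metric.cauchySeq_iff']
    intro ε hε
    obtain ⟨N, hN⟩ := (hlim0.eventually (gt_mem_nhds (half_pos hε))).exists_forall_of_atTop
    refine ⟨N, fun n hn => ?_⟩
    rw [dist_eq_norm]
    linarith [hdist n N x, hN n hn, hN N le_rfl]
  choose b hb using fun x => cauchySeq_tendsto_of_complete (hcauchy x)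
  have hab : ∀ n x, ‖a n x - b x‖ ≤ 1 / ((n : ℝ) + 1) := by
    intro n x
    have h3 := ((hb x).const_sub (a n x)).norm
    have h4 := hlim0.const_add (1 / ((n : ℝ) + 1))
    rw [add_zero] at h4
    exact le_of_tendsto_of_tendsto' h3 h4 fun m => hdist n m x
  have hbS : b ∈ CylS := by
    apply uniformClosure_uniformClosure_le
    intro ε hε
    obtain ⟨n, hn⟩ := exists_nat_one_div_lt hε
    exact ⟨a n, ha n, fun x => by rw [norm_sub_rev]; exact (hab n x).trans hn.le⟩
  have hfb : f - b ∈ VanishingAtInfinity := by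
    apply uniformClosure_vanishingAtInfinity_le
    intro ε hε
    obtain ⟨n, hn⟩ := exists_nat_one_div_lt (half_pos hε)
    refine ⟨v n, hv n, fun x => ?_⟩
    have h5 : (f - b) x - v n x = (f x - (a n x + v n x)) + (a n x - b x) := by
      simp only [Pi.sub_apply]
      ring
    rw [h5]
    exact (norm_add_le _ _).trans (by linarith [hav n x, hab n x])
  exact Submodule.mem_sup.2 ⟨b, hbS, f - b, hfb, by simp⟩

/-- The functions that differ from a trigonometric polynomial by a continuous function that
vanishes at infinity. -/
def AsymptoticallyTrig : StarSubalgebra ℂ (ℝ → ℂ) where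
  carrier := {f | ∃ a ∈ TrigPolynomial, ∃ v ∈ VanishingAtInfinity, f = a + v}
  mul_mem' := by
    rintro _ _ ⟨a, ha, v, hv, rfl⟩ ⟨b, hb, w, hw, rfl⟩
    obtain ⟨C, hC⟩ := TrigPolynomial.exists_bound ha
    obtain ⟨D, hD⟩ := TrigPolynomial.exists_bound hb
    have ha' := TrigPolynomial.continuous ha
    have hb' := TrigPolynomial.continuous hb
    refine ⟨a * b, TrigPolynomial.mul_mem ha hb, a * w + b * v + v * w, ?_, by ring⟩
    have h1 : Tendsto (a * w) (cocompact ℝ) (𝓝 0) := by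
      refine squeeze_zero_norm (a := fun x => C * ‖w x‖) (fun x => ?_) ?_
      · rw [Pi.mul_apply, norm_mul]
        exact mul_le_mul_of_nonneg_right (hC x) (norm_nonneg _)
      · simpa using hw.2.norm.const_mul C
    have h2 : Tendsto (b * v) (cocompact ℝ) (𝓝 0) := by
      refine squeeze_zero_norm (a := fun x => D * ‖v x‖) (fun x => ?_) ?_
      · rw [Pi.mul_apply, norm_mul]
        exact mul_le_mul_of_nonneg_right (hD x) (norm_nonneg _)
      · simpa using hv.2.norm.const_mul D
    have h3 : Tendsto (v * w) (cocompact ℝ) (𝓝 0) := by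
      have := hv.2.mul hw.2
      rwa [mul_zero] at this
    refine VanishingAtInfinity.add_mem (VanishingAtInfinity.add_mem ?_ ?_) ?_
    · exact ⟨ha'.mul hw.1, h1⟩
    · exact ⟨hb'.mul hv.1, h2⟩
    · exact ⟨hv.1.mul hw.1, h3⟩
  add_mem' := by
    rintro _ _ ⟨a, ha, v, hv, rfl⟩ ⟨b, hb, w, hw, rfl⟩
    exact ⟨a + b, TrigPolynomial.add_mem ha hb, v + w, VanishingAtInfinity.add_mem hv hw, by ring⟩
  algebraMap_mem' z := ⟨fun _ => z, const_mem_trigPolynomial z, 0, VanishingAtInfinity.zero_mem,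
    by ext; simp⟩
  star_mem' := by
    rintro _ ⟨a, ha, v, hv, rfl⟩
    refine ⟨star a, TrigPolynomial.star_mem ha, star v, ⟨continuous_star.comp hv.1, ?_⟩,
      star_add _ _⟩
    have := hv.2.star
    rwa [star_zero] at this

theorem uniformClosure_asymptoticallyTrig_le :
    uniformClosure (Subalgebra.toSubmodule AsymptoticallyTrig.toSubalgebra) ≤
      CylS ⊔ VanishingAtInfinity := by
  refine (uniformClosure_mono ?_).trans uniformClosure_sup_le
  rintro _ ⟨a, ha, v, hv, rfl⟩
  exact Submodule.add_mem_sup (le_uniformClosure _ ha) hv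

/-! ### Holonomies along a ray of isotropic connections -/

theorem vanishingAtInfinity_of_abs_mul_norm_le {f : ℝ → ℂ} (hf : Continuous f) {C : ℝ}
    (h : ∀ c, |c| * ‖f c‖ ≤ C) : f ∈ VanishingAtInfinity := by
  refine ⟨hf, ?_⟩
  have hc : Tendsto (fun c : ℝ => |c|) (cocompact ℝ) atTop := tendsto_norm_cocompact_atTop
  refine squeeze_zero_norm' (a := fun c => C / |c|) ?_ (tendsto_const_nhds.div_atTop hc)
  filter_upwards [hc.eventually_gt_atTop 0] with c hc
  rw [le_div_iff₀ hc, mul_comm]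
  exact h c

/-- The asymptotic form of the holonomy is trigonometric in `c`, and the remainder is `O(1/|c|)`
because `k ≠ 0`. -/
theorem ofReal_mem_asymptoticallyTrig (ℓ : ℍ[ℝ] →ₗ[ℝ] ℝ) (e : AnalyticArc) {k : ℝ}
    (hk : k ≠ 0) :
    (fun c : ℝ => ((ℓ (quaternionHolonomy e (c * k)) : ℝ) : ℂ)) ∈ AsymptoticallyTrig := by
  obtain ⟨g₁, n₀, L, C, h⟩ := exists_quaternionHolonomy_asymptotics e
  set z : ℝ → ℍ[ℝ] := fun c => g₁ * (((Real.cos (c * k * L / 2) : ℝ) : ℍ[ℝ])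
        - ((Real.sin (c * k * L / 2) : ℝ) : ℍ[ℝ]) * n₀) with hz
  have hzc : Continuous z := by
    refine continuous_const.mul (Continuous.sub ?_ (Continuous.mul ?_ continuous_const)) <;>
      exact Quaternion.continuous_coe.comp (by fun_prop)
  have h1 : (fun c => ((ℓ (z c) : ℝ) : ℂ)) ∈ TrigPolynomial := by
    have := TrigPolynomial.sub_mem
      (TrigPolynomial.smul_mem ((ℓ g₁ : ℝ) : ℂ) (cos_mem_trigPolynomial (k * L / 2)))
      (TrigPolynomial.smul_mem ((ℓ (g₁ * n₀) : ℝ) : ℂ) (sin_mem_trigPolynomial (k * L / 2)))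
    convert this using 1
    ext c
    have h2 : z c = Real.cos (c * (k * L / 2)) • g₁ - Real.sin (c * (k * L / 2)) • (g₁ * n₀) := by
      simp only [hz, Quaternion.coe_mul_eq_smul, mul_sub, mul_smul_comm, Quaternion.mul_coe_eq_smul]
      rw [show c * k * L / 2 = c * (k * L / 2) by ring]
    rw [h2, map_sub, map_smul, map_smul]
    simp [mul_comm]
  have hℓc : Continuous ℓ := ℓ.continuous_of_finiteDimensional
  obtain ⟨D, hD⟩ : ∃ D, ∀ q, |ℓ q| ≤ D * ‖q‖ :=
    ⟨‖LinearMap.toContinuousLinearMap ℓ‖, fun q =>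
      (LinearMap.toContinuousLinearMap ℓ).le_opNorm q⟩
  have hD0 : 0 ≤ D := by simpa using (abs_nonneg _).trans (hD 1)
  have h3 : (fun c => ((ℓ (quaternionHolonomy e (c * k) - z c) : ℝ) : ℂ)) ∈
      VanishingAtInfinity := by
    have hcont : Continuous fun c => quaternionHolonomy e (c * k) :=
      (continuous_quaternionHolonomy e).comp (by fun_prop)
    refine vanishingAtInfinity_of_abs_mul_norm_le
      (Complex.continuous_ofReal.comp (hℓc.comp (hcont.sub hzc))) (C := D * C / |k|) fun c => ?_
    rw [le_div_iff₀ (abs_pos.2 hk), Complex.norm_real, Real.norm_eq_abs]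
    calc |c| * |ℓ (quaternionHolonomy e (c * k) - z c)| * |k|
        ≤ |c| * (D * ‖quaternionHolonomy e (c * k) - z c‖) * |k| := by
          gcongr
          exact hD _
      _ = D * (|c * k| * ‖quaternionHolonomy e (c * k) - z c‖) := by rw [abs_mul]; ring
      _ ≤ D * C := mul_le_mul_of_nonneg_left (h (c * k)) hD0
  refine ⟨_, h1, _, h3, ?_⟩
  ext c
  simp

theorem arcHolonomy_mem_asymptoticallyTrig {A : Connection} {k : ℝ} (hA : A.IsIsotropic k)
    (hk : k ≠ 0) (e : AnalyticArc) (i j : Fin 2) :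
    (fun c : ℝ => (arcHolonomy (ray A c) e).1 i j) ∈ AsymptoticallyTrig := by
  let re : ℍ[ℝ] →ₗ[ℝ] ℝ := ⟨⟨fun q => (quaternionMatrix q i j).re, fun p q => by
    fin_cases i <;> fin_cases j <;> simp [quaternionMatrix] <;> ring⟩, fun r q => by
    fin_cases i <;> fin_cases j <;> simp [quaternionMatrix]⟩
  let im : ℍ[ℝ] →ₗ[ℝ] ℝ := ⟨⟨fun q => (quaternionMatrix q i j).im, fun p q => by
    fin_cases i <;> fin_cases j <;> simp [quaternionMatrix] <;> ring⟩, fun r q => by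
    fin_cases i <;> fin_cases j <;> simp [quaternionMatrix]⟩
  have := AsymptoticallyTrig.add_mem (ofReal_mem_asymptoticallyTrig re e hk)
    (AsymptoticallyTrig.smul_mem (ofReal_mem_asymptoticallyTrig im e hk) Complex.I)
  refine (congrArg (· ∈ AsymptoticallyTrig) ?_).mpr this
  ext c
  rw [arcHolonomy_eq_quaternionHolonomy (hA.ray c)]
  simp only [Pi.add_apply, Pi.smul_apply, smul_eq_mul]
  rw [mul_comm Complex.I]
  exact (Complex.re_add_im _).symm

theorem holonomy_mem_asymptoticallyTrig {A : Connection} {k : ℝ} (hA : A.IsIsotropic k)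
    (hk : k ≠ 0) (l : PiecewiseAnalyticPath) (i j : Fin 2) :
    (fun c : ℝ => (holonomy (ray A c) l).1 i j) ∈ AsymptoticallyTrig := by
  suffices h : ∀ (l : List AnalyticArc) (i j : Fin 2),
      (fun c : ℝ => (listHolonomy (ray A c) l).1 i j) ∈ AsymptoticallyTrig from h _ _ _
  intro l
  induction l with
  | nil => exact fun i j => AsymptoticallyTrig.algebraMap_mem ((1 : Matrix _ _ ℂ) i j)
  | cons e l ih =>
    intro i j
    have := AsymptoticallyTrig.sum_mem (t := Finset.univ) fun (m : Fin 2) _ =>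
      AsymptoticallyTrig.mul_mem (ih i m) (arcHolonomy_mem_asymptoticallyTrig hA hk e m j)
    refine (congrArg (· ∈ AsymptoticallyTrig) ?_).mpr this
    ext c
    simp [listHolonomy, Matrix.mul_apply]

/-! ### From matrix entries to continuous functions of holonomies -/

theorem compactSpace_SU2 : CompactSpace SU2 := by
  suffices h : IsCompact (Matrix.specialUnitaryGroup (Fin 2) ℂ : Set (Matrix (Fin 2) (Fin 2) ℂ)) from
    isCompact_iff_compactSpace.1 h
  have hb : (Matrix.specialUnitaryGroup (Fin 2) ℂ : Set (Matrix (Fin 2) (Fin 2) ℂ)) ⊆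
      Set.pi Set.univ fun _ => Set.pi Set.univ fun _ => Metric.closedBall (0 : ℂ) 1 := by
    intro U hU i _ j _
    rw [mem_closedBall_zero_iff]
    exact entry_norm_bound_of_unitary (Matrix.mem_specialUnitaryGroup_iff.1 hU).1 i j
  refine IsCompact.of_isClosed_subset
    (isCompact_univ_pi fun _ => isCompact_univ_pi fun _ => isCompact_closedBall _ _) ?_ hb
  have : (Matrix.specialUnitaryGroup (Fin 2) ℂ : Set (Matrix (Fin 2) (Fin 2) ℂ)) =
      {U | U * star U = 1} ∩ {U | U.det = 1} := by
    ext U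
    simp [Matrix.mem_specialUnitaryGroup_iff, Matrix.mem_unitaryGroup_iff]
  rw [this]
  exact (isClosed_eq (by fun_prop) continuous_const).inter
    (isClosed_eq (by fun_prop) continuous_const)

/-- The continuous `G` on `SU(2)^n` whose composition with the holonomies is asymptotically
trigonometric form a star subalgebra. It contains the matrix entries, so it separates points and is
dense by Stone–Weierstrass. -/
theorem map_cylFinite_le {A : Connection} {k : ℝ} (hA : A.IsIsotropic k) (hk : k ≠ 0) :
    CylFinite.map (LinearMap.funLeft ℂ ℂ (ray A)) ≤ CylS ⊔ VanishingAtInfinity := by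
  rintro _ ⟨Φ, ⟨n, l, F, hF⟩, rfl⟩
  have := compactSpace_SU2
  apply uniformClosure_asymptoticallyTrig_le
  let h : ℝ → Fin n → SU2 := fun c m => holonomy (ray A c) (l m)
  let B : StarSubalgebra ℂ C(Fin n → SU2, ℂ) :=
    AsymptoticallyTrig.comap
      { toFun := fun G c => G (h c)
        map_one' := rfl
        map_mul' := fun _ _ => rfl
        map_zero' := rfl
        map_add' := fun _ _ => rfl
        commutes' := fun _ => rfl
        map_star' := fun _ => rfl }
  have hB : B.SeparatesPoints := by
    intro x y hxy
    obtain ⟨m, hm⟩ := Function.ne_iff.1 hxy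
    have : ∃ i j, (x m).1 i j ≠ (y m).1 i j := by
      by_contra! hc
      exact hm (Subtype.ext (Matrix.ext hc))
    obtain ⟨i, j, hij⟩ := this
    refine ⟨fun u => (u m).1 i j, ⟨⟨fun u => (u m).1 i j,
      (continuous_subtype_val.comp (continuous_apply m)).matrix_elem i j⟩, ?_, rfl⟩, hij⟩
    exact holonomy_mem_asymptoticallyTrig hA hk (l m) i j
  have htop := ContinuousMap.starSubalgebra_topologicalClosure_eq_top_of_separatesPoints B hB
  have hFB : F ∈ closure (B : Set C(Fin n → SU2, ℂ)) := by
    rw [← StarSubalgebra.topologicalClosure_coe, htop]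
    trivial
  intro ε hε
  obtain ⟨G, hG, hFG⟩ := Metric.mem_closure_iff.1 hFB ε hε
  refine ⟨fun c => G (h c), hG, fun c => ?_⟩
  have h1 := (ContinuousMap.dist_apply_le_dist (f := F) (g := G) (h c)).trans hFG.le
  rw [dist_eq_norm] at h1
  simpa [hF, LinearMap.funLeft_apply] using h1

theorem cylF_le {A : Connection} {k : ℝ} (hA : A.IsIsotropic k) (hk : k ≠ 0) :
    CylF A ≤ CylS ⊔ VanishingAtInfinity := by
  rintro _ ⟨Φ, hΦ, rfl⟩
  apply uniformClosure_sup_le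
  intro ε hε
  obtain ⟨Ψ, hΨ, h⟩ := hΦ ε hε
  exact ⟨_, map_cylFinite_le hA hk ⟨Ψ, hΨ, rfl⟩, fun c => h _⟩

end LQC

end

noncomputable section

namespace LQC

open Filter Topology Quaternion

/-! ### Restrictions of cylindrical functions to a ray -/

theorem CylFinite.mul_mem {Φ Ψ : Connection → ℂ} (hΦ : Φ ∈ CylFinite) (hΨ : Ψ ∈ CylFinite) :
    Φ * Ψ ∈ CylFinite := by
  obtain ⟨n, l, F, h₁⟩ := hΦ
  obtain ⟨m, l', G, h₂⟩ := hΨ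
  refine ⟨n + m, Fin.append l l',
    ⟨fun u => F (fun k => u (Fin.castAdd m k)) * G (fun k => u (Fin.natAdd n k)),
      by fun_prop⟩, fun A => ?_⟩
  simp [h₁, h₂]

theorem CylFinite.comp_mem {Φ : Connection → ℂ} (hΦ : Φ ∈ CylFinite) (f : C(ℂ, ℂ)) :
    (fun A => f (Φ A)) ∈ CylFinite := by
  obtain ⟨n, l, F, h⟩ := hΦ
  exact ⟨n, l, f.comp F, fun A => congrArg f (h A)⟩

theorem CylFinite.const_mem (z : ℂ) : (fun _ => z) ∈ CylFinite :=
  ⟨0, Fin.elim0, ContinuousMap.const _ z, fun _ => rfl⟩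

theorem CylFinite.holonomy_mem (l : PiecewiseAnalyticPath) (i j : Fin 2) :
    (fun A => (holonomy A l).1 i j) ∈ CylFinite :=
  ⟨1, fun _ => l, ⟨fun u => (u 0).1 i j,
    (continuous_subtype_val.comp (continuous_apply 0)).matrix_elem i j⟩, fun _ => rfl⟩

/-- A continuous map of the complex plane into a disk that fixes the points of that disk. -/
def radialRetraction (ρ : ℝ) (hρ : 0 < ρ) : C(ℂ, ℂ) where
  toFun z := ((ρ / max ρ ‖z‖ : ℝ) : ℂ) * z
  continuous_toFun := by
    refine (Complex.continuous_ofReal.comp (continuous_const.div (by fun_prop) fun z => ?_)).mul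
      continuous_id
    exact (lt_max_of_lt_left hρ).ne'

theorem norm_radialRetraction_le {ρ : ℝ} (hρ : 0 < ρ) (z : ℂ) : ‖radialRetraction ρ hρ z‖ ≤ ρ := by
  have h : 0 < max ρ ‖z‖ := lt_max_of_lt_left hρ
  show ‖((ρ / max ρ ‖z‖ : ℝ) : ℂ) * z‖ ≤ ρ
  rw [norm_mul, Complex.norm_real, Real.norm_of_nonneg (by positivity), div_mul_eq_mul_div,
    div_le_iff₀ h]
  exact mul_le_mul_of_nonneg_left (le_max_right _ _) hρ.le

theorem radialRetraction_eq {ρ : ℝ} (hρ : 0 < ρ) {z : ℂ} (hz : ‖z‖ ≤ ρ) :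
    radialRetraction ρ hρ z = z := by
  show ((ρ / max ρ ‖z‖ : ℝ) : ℂ) * z = z
  rw [max_eq_left hz, div_self hρ.ne', Complex.ofReal_one, one_mul]

/-- Approximants that are close on the ray may be far apart at other connections. Truncating their
successive differences repairs this without changing values on the ray, and the telescoping series
then converges uniformly over all connections to a lift of `f`. -/
theorem uniformClosure_map_cylFinite_le (A : Connection) :
    uniformClosure (CylFinite.map (LinearMap.funLeft ℂ ℂ (ray A))) ≤ CylF A := by
  intro f hf
  have h1 : ∀ n : ℕ, ∃ Ψ ∈ CylFinite, ∀ c, ‖f c - Ψ (ray A c)‖ ≤ (1 / 2 : ℝ) ^ n := by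
    intro n
    obtain ⟨_, ⟨Ψ, hΨ, rfl⟩, h⟩ := hf ((1 / 2 : ℝ) ^ n) (by positivity)
    exact ⟨Ψ, hΨ, h⟩
  choose Ψ hΨ hfΨ using h1
  have hρ : ∀ n : ℕ, 0 < 2 * (1 / 2 : ℝ) ^ n := fun n => by positivity
  -- On the ray the difference is at most `2⁻ⁿ + 2⁻⁽ⁿ⁺¹⁾ ≤ 2 · 2⁻ⁿ`, so the retraction of radius `2
  -- · 2⁻ⁿ` fixes it there.
  let d : ℕ → Connection → ℂ := fun n B =>
    radialRetraction _ (hρ n) (Ψ (n + 1) B - Ψ n B)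
  have hd : ∀ n, d n ∈ CylFinite := fun n =>
    CylFinite.comp_mem (CylFinite.sub_mem (hΨ (n + 1)) (hΨ n)) _
  have hdn : ∀ n B, ‖d n B‖ ≤ 2 * (1 / 2 : ℝ) ^ n := fun n B => norm_radialRetraction_le _ _
  have hdr : ∀ n c, d n (ray A c) = Ψ (n + 1) (ray A c) - Ψ n (ray A c) := by
    intro n c
    apply radialRetraction_eq
    have h2 : Ψ (n + 1) (ray A c) - Ψ n (ray A c) =
      (f c - Ψ n (ray A c)) - (f c - Ψ (n + 1) (ray A c)) := by ring
    have h3 : (1 / 2 : ℝ) ^ (n + 1) ≤ (1 / 2 : ℝ) ^ n :=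
      pow_le_pow_of_le_one (by norm_num) (by norm_num) n.le_succ
    rw [h2]
    exact (norm_sub_le _ _).trans (by linarith [hfΨ n c, hfΨ (n + 1) c])
  have hunif := tendstoUniformly_tsum_nat
    ((summable_geometric_of_lt_one (r := (1 / 2 : ℝ)) (by norm_num) (by norm_num)).mul_left 2) hdn
  refine ⟨fun B => Ψ 0 B + ∑' n, d n B, fun ε hε => ?_, ?_⟩
  · obtain ⟨N, hN⟩ := (Metric.tendstoUniformly_iff.1 hunif ε hε).exists
    refine ⟨Ψ 0 + ∑ n ∈ Finset.range N, d n,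
      CylFinite.add_mem (hΨ 0) (CylFinite.sum_mem fun n _ => hd n), fun B => ?_⟩
    have := (hN B).le
    rw [dist_eq_norm] at this
    simpa using this
  · ext c
    show Ψ 0 (ray A c) + ∑' n, d n (ray A c) = f c
    have h4 : Tendsto (fun N => Ψ 0 (ray A c) + ∑ n ∈ Finset.range N, d n (ray A c)) atTop
        (𝓝 (Ψ 0 (ray A c) + ∑' n, d n (ray A c))) :=
      (hunif.tendsto_at (ray A c)).const_add _
    refine tendsto_nhds_unique h4 ?_
    have h5 : ∀ N, Ψ 0 (ray A c) + ∑ n ∈ Finset.range N, d n (ray A c) = Ψ N (ray A c) := by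
      intro N
      simp only [hdr]
      rw [Finset.sum_range_sub (fun n => Ψ n (ray A c))]
      ring
    simp only [h5]
    rw [tendsto_iff_norm_sub_tendsto_zero]
    refine squeeze_zero (fun _ => norm_nonneg _) (fun N => ?_)
      (tendsto_pow_atTop_nhds_zero_of_lt_one (r := (1 / 2 : ℝ)) (by norm_num) (by norm_num))
    rw [norm_sub_rev]
    exact hfΨ N c

/-- The restrictions to the ray `c ↦ c A` of functions of finitely many holonomies. -/
def RayCylinder (A : Connection) : StarSubalgebra ℂ (ℝ → ℂ) where
  carrier := CylFinite.map (LinearMap.funLeft ℂ ℂ (ray A))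
  mul_mem' := by
    rintro _ _ ⟨Φ, hΦ, rfl⟩ ⟨Ψ, hΨ, rfl⟩
    exact ⟨Φ * Ψ, CylFinite.mul_mem hΦ hΨ, rfl⟩
  add_mem' := Submodule.add_mem _
  algebraMap_mem' z := ⟨_, CylFinite.const_mem z, rfl⟩
  star_mem' := by
    rintro _ ⟨Φ, hΦ, rfl⟩
    exact ⟨_, CylFinite.comp_mem hΦ ⟨star, continuous_star⟩, rfl⟩

theorem arcHolonomy_mem_rayCylinder (A : Connection) (e : AnalyticArc) (i j : Fin 2) :
    (fun c => (arcHolonomy (ray A c) e).1 i j) ∈ RayCylinder A := by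
  refine ⟨_, CylFinite.holonomy_mem ⟨[e], List.isChain_singleton e⟩ i j, ?_⟩
  ext c
  simp [LinearMap.funLeft_apply, holonomy, listHolonomy]

/-! ### Straight lines and circles -/

/-- The quaternion with the given components. -/
def quaternionOf (a b c d : ℝ) : ℍ[ℝ] := ⟨a, b, c, d⟩

@[simp] theorem quaternionOf_re (a b c d : ℝ) : (quaternionOf a b c d).re = a := rfl
@[simp] theorem quaternionOf_imI (a b c d : ℝ) : (quaternionOf a b c d).imI = b := rfl
@[simp] theorem quaternionOf_imJ (a b c d : ℝ) : (quaternionOf a b c d).imJ = c := rfl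
@[simp] theorem quaternionOf_imK (a b c d : ℝ) : (quaternionOf a b c d).imK = d := rfl

/-- A straight line along the third axis. -/
def lineArc (w : ℝ) (hw : w ≠ 0) : AnalyticArc where
  toFun t := ![0, 0, w * t]
  analytic t _ := by
    rw [analyticAt_pi_iff]
    intro i
    fin_cases i <;> simp <;> fun_prop
  regular t _ h := by
    have h1 : HasDerivAt (fun t : ℝ => (![0, 0, w * t] : Space)) ![0, 0, w] t := by
      rw [hasDerivAt_pi]
      intro i
      fin_cases i
      · exact hasDerivAt_const _ _
      · exact hasDerivAt_const _ _
      · simpa using (hasDerivAt_id t).const_mul w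
    rw [h1.deriv] at h
    exact hw (by simpa using congrFun h 2)

theorem deriv_lineArc (w : ℝ) (hw : w ≠ 0) (t : ℝ) :
    deriv (lineArc w hw).toFun t = ![0, 0, w] := by
  apply HasDerivAt.deriv
  rw [hasDerivAt_pi]
  intro i
  fin_cases i
  · exact hasDerivAt_const _ _
  · exact hasDerivAt_const _ _
  · simpa using! (hasDerivAt_id t).const_mul w

theorem isQuaternionTransport_lineArc (k w : ℝ) (hw : w ≠ 0) :
    IsQuaternionTransport k (lineArc w hw) fun t =>
      quaternionOf (Real.cos (k * w / 2 * t)) 0 0 (-Real.sin (k * w / 2 * t)) := by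
  constructor
  · ext <;> simp
  · intro t _
    have hθ : HasDerivWithinAt (fun t : ℝ => k * w / 2 * t) (k * w / 2) (Set.Icc 0 1) t := by
      simpa using ((hasDerivAt_id t).const_mul (k * w / 2)).hasDerivWithinAt
    rw [deriv_lineArc]
    refine hasDerivWithinAt_quaternion ?_ ?_ ?_ ?_
    · refine hθ.cos.congr_deriv ?_
      simp
      ring
    · refine (hasDerivWithinAt_const _ _ _).congr_deriv ?_
      simp
    · refine (hasDerivWithinAt_const _ _ _).congr_deriv ?_
      simp
    · refine hθ.sin.neg.congr_deriv ?_
      simp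
      ring

theorem exp_mem_rayCylinder {A : Connection} {k : ℝ} (hA : A.IsIsotropic k) (hk : k ≠ 0)
    (μ : ℝ) : (fun c : ℝ => Complex.exp (Complex.I * (μ : ℂ) * (c : ℂ))) ∈ RayCylinder A := by
  by_cases hμ : μ = 0
  · refine (congrArg (· ∈ RayCylinder A) ?_).mpr (RayCylinder A).one_mem
    ext c
    simp [hμ]
  · have hw : 2 * μ / k ≠ 0 := div_ne_zero (mul_ne_zero two_ne_zero hμ) hk
    refine (congrArg (· ∈ RayCylinder A) ?_).mpr
      (arcHolonomy_mem_rayCylinder A (lineArc (2 * μ / k) hw) 0 0)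
    ext c
    rw [(isQuaternionTransport_lineArc (c * k) _ hw).arcHolonomy_eq (hA.ray c)]
    have h1 : c * k * (2 * μ / k) / 2 * 1 = μ * c := by field_simp
    have h2 : Complex.I * (μ : ℂ) * (c : ℂ) = ((μ * c : ℝ) : ℂ) * Complex.I := by push_cast; ring
    rw [h1, h2]
    apply Complex.ext
    · rw [Complex.exp_ofReal_mul_I_re]
      rfl
    · rw [Complex.exp_ofReal_mul_I_im]
      exact (neg_neg _).symm

theorem trigPolynomial_le_rayCylinder {A : Connection} {k : ℝ} (hA : A.IsIsotropic k)
    (hk : k ≠ 0) : TrigPolynomial ≤ CylFinite.map (LinearMap.funLeft ℂ ℂ (ray A)) := by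
  refine Submodule.span_le.2 ?_
  rintro _ ⟨μ, rfl⟩
  exact exp_mem_rayCylinder hA hk μ

theorem cylS_le_cylF {A : Connection} {k : ℝ} (hA : A.IsIsotropic k) (hk : k ≠ 0) :
    CylS ≤ CylF A :=
  (uniformClosure_mono (trigPolynomial_le_rayCylinder hA hk)).trans
    (uniformClosure_map_cylFinite_le A)

theorem hasDerivAt_circle (s t : ℝ) :
    HasDerivAt (fun t : ℝ => (![s * Real.sin t, -(s * Real.cos t), 0] : Space))
      ![s * Real.cos t, s * Real.sin t, 0] t := by
  rw [hasDerivAt_pi]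
  intro i
  fin_cases i
  · exact (Real.hasDerivAt_sin t).const_mul s
  · simpa using! ((Real.hasDerivAt_cos t).const_mul s).neg
  · exact hasDerivAt_const _ _

/-- An arc of angle one on a circle of radius `s`. -/
def circleArc (s : ℝ) (hs : s ≠ 0) : AnalyticArc where
  toFun t := ![s * Real.sin t, -(s * Real.cos t), 0]
  analytic t _ := by
    rw [analyticAt_pi_iff]
    intro i
    fin_cases i <;> simp <;> fun_prop
  regular t _ h := by
    rw [(hasDerivAt_circle s t).deriv] at h
    have h0 := congrFun h 0
    have h1 := congrFun h 1
    simp [hs] at h0 h1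
    have := Real.sin_sq_add_cos_sq t
    rw [h0, h1] at this
    norm_num at this

/-- The frequency of rotation of the parallel transport along a circle. -/
def circleFrequency (k s : ℝ) : ℝ := √(1 + (k * s) ^ 2) / 2

theorem circleFrequency_pos (k s : ℝ) : 0 < circleFrequency k s :=
  div_pos (Real.sqrt_pos.2 (by positivity)) two_pos

theorem circleFrequency_sq (k s : ℝ) : 4 * circleFrequency k s ^ 2 = 1 + (k * s) ^ 2 := by
  rw [circleFrequency, div_pow, Real.sq_sqrt (by positivity)]
  ring

/-- In the frame turning with the tangent the equation has constant coefficients. With imaginary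
units `e₁, e₂, e₃`, the solution is `exp(t e₃/2) exp(-t (k s e₁ + e₃)/2)`, and the second generator
has norm `circleFrequency k s`. -/
theorem isQuaternionTransport_circleArc (k s : ℝ) (hs : s ≠ 0) :
    IsQuaternionTransport k (circleArc s hs) fun t => quaternionOf
      (Real.cos (1 / 2 * t) * Real.cos (circleFrequency k s * t) + Real.sin (1 / 2 * t) *
        Real.sin (circleFrequency k s * t) * (2 * circleFrequency k s)⁻¹)
      (-(k * s) * (Real.cos (1 / 2 * t) * Real.sin (circleFrequency k s * t) *
        (2 * circleFrequency k s)⁻¹))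
      (-(k * s) * (Real.sin (1 / 2 * t) * Real.sin (circleFrequency k s * t) *
        (2 * circleFrequency k s)⁻¹))
      (Real.sin (1 / 2 * t) * Real.cos (circleFrequency k s * t) - Real.cos (1 / 2 * t) *
        Real.sin (circleFrequency k s * t) * (2 * circleFrequency k s)⁻¹) := by
  have hw := circleFrequency_pos k s
  have hw2 := circleFrequency_sq k s
  have hβ := mul_inv_cancel₀ (mul_pos two_pos hw).ne'
  set w := circleFrequency k s
  set β := (2 * w)⁻¹
  constructor
  · ext <;> simp
  · intro t _
    rw [show deriv (circleArc s hs).toFun t = _ from (hasDerivAt_circle s t).deriv]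
    have hlin : ∀ a : ℝ, HasDerivWithinAt (fun t : ℝ => a * t) a (Set.Icc 0 1) t := fun a => by
      simpa using ((hasDerivAt_id t).const_mul a).hasDerivWithinAt
    have ha := (hlin (1 / 2)).cos
    have hb := (hlin (1 / 2)).sin
    have hA := (hlin w).cos
    have hB := (hlin w).sin
    have hct : Real.cos t = 2 * Real.cos (1 / 2 * t) ^ 2 - 1 := by
      rw [← Real.cos_two_mul]; ring_nf
    have hst : Real.sin t = 2 * Real.sin (1 / 2 * t) * Real.cos (1 / 2 * t) := by
      rw [← Real.sin_two_mul]; ring_nf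
    have hab := Real.sin_sq_add_cos_sq (1 / 2 * t)
    rw [hct, hst]
    refine hasDerivWithinAt_quaternion ((ha.mul hA).add ((hb.mul hB).mul_const β) |>.congr_deriv ?_)
      (((ha.mul hB).mul_const β).const_mul (-(k * s)) |>.congr_deriv ?_)
      (((hb.mul hB).mul_const β).const_mul (-(k * s)) |>.congr_deriv ?_)
      ((hb.mul hA).sub ((ha.mul hB).mul_const β) |>.congr_deriv ?_)
    all_goals
      clear ha hb hA hB hct hst
      simp only [Quaternion.re_mul, Quaternion.imI_mul, Quaternion.imJ_mul, Quaternion.imK_mul,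
        Quaternion.re_smul, Quaternion.imI_smul, Quaternion.imJ_smul, Quaternion.imK_smul,
        imaginary_re, imaginary_imI, imaginary_imJ, imaginary_imK, quaternionOf_re,
        quaternionOf_imI, quaternionOf_imJ, quaternionOf_imK, smul_eq_mul, Matrix.cons_val]
      generalize Real.cos (1 / 2 * t) = a at *
      generalize Real.sin (1 / 2 * t) = b at *
      generalize Real.cos (w * t) = A at *
      generalize Real.sin (w * t) = B at *
    · linear_combination (b * A / 2 + a * B * w) * hβ - (β * B * a / 2) * hw2
        + (k * s) ^ 2 * β * B * a * hab
    · linear_combination -(k * s * a * A / 2) * hβ + k * s * a * A * hab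
    · linear_combination -(k * s * b * A / 2) * hβ + k * s * a * B * β * hab
    · linear_combination (-(a * A / 2) + b * B * w) * hβ - (β * B * b / 2) * hw2

/-- A function on the ray, obtained from the holonomy along a circle, that vanishes at infinity. -/
def circleFunction (k s c : ℝ) : ℂ :=
  ((Real.sin (circleFrequency (c * k) s) / (2 * circleFrequency (c * k) s) : ℝ) : ℂ)

/-- The diagonal entries give the real part and the third imaginary component of the holonomy.
Weighting these by `sin (1/2)` and `-cos (1/2)` eliminates `cos ω` and leaves `sin ω / (2ω)`, with
`ω` the circle frequency. -/
theorem circleFunction_mem_rayCylinder {A : Connection} {k : ℝ} (hA : A.IsIsotropic k)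
    {s : ℝ} (hs : s ≠ 0) : circleFunction k s ∈ RayCylinder A := by
  have h1 := arcHolonomy_mem_rayCylinder A (circleArc s hs) 0 0
  have h2 := arcHolonomy_mem_rayCylinder A (circleArc s hs) 1 1
  have h3 := (RayCylinder A).sub_mem
    ((RayCylinder A).smul_mem ((RayCylinder A).add_mem h1 h2) ((Real.sin (1 / 2) / 2 : ℝ) : ℂ))
    ((RayCylinder A).smul_mem ((RayCylinder A).sub_mem h1 h2)
      (((Real.cos (1 / 2) / 2 : ℝ) : ℂ) * Complex.I))
  refine (congrArg (· ∈ RayCylinder A) ?_).mpr h3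
  ext c
  have hab := Real.sin_sq_add_cos_sq (1 / 2)
  simp only [Pi.sub_apply, Pi.add_apply, Pi.smul_apply, smul_eq_mul,
    (isQuaternionTransport_circleArc (c * k) s hs).arcHolonomy_eq (hA.ray c)]
  have h00 : ∀ q, quaternionMatrix q 0 0 = ⟨q.re, -q.imK⟩ := fun _ => rfl
  have h11 : ∀ q, quaternionMatrix q 1 1 = ⟨q.re, q.imK⟩ := fun _ => rfl
  simp only [h00, h11, quaternionOf_re, quaternionOf_imK, circleFunction, mul_one,
    div_eq_mul_inv] at hab ⊢
  generalize Real.sin (1 * 2⁻¹) = b at *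
  generalize Real.cos (1 * 2⁻¹) = a at *
  generalize Real.sin (circleFrequency (c * k) s) = y
  generalize (2 * circleFrequency (c * k) s)⁻¹ = z
  apply Complex.ext
  · simp
    linear_combination -(y * z) * hab
  · simp

theorem continuous_circleFunction (k s : ℝ) : Continuous (circleFunction k s) := by
  have h : Continuous fun c : ℝ => circleFrequency (c * k) s := by
    unfold circleFrequency
    fun_prop
  exact Complex.continuous_ofReal.comp ((Real.continuous_sin.comp h).div (continuous_const.mul h)
    fun c => (mul_pos two_pos (circleFrequency_pos _ _)).ne')

theorem circleFunction_mem_vanishingAtInfinity {k s : ℝ} (hk : k ≠ 0) (hs : s ≠ 0) :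
    circleFunction k s ∈ VanishingAtInfinity := by
  refine vanishingAtInfinity_of_abs_mul_norm_le (continuous_circleFunction k s)
    (C := 1 / |k * s|) fun c => ?_
  have hω := circleFrequency_pos (c * k) s
  have h1 : |c * k * s| ≤ 2 * circleFrequency (c * k) s := by
    apply abs_le_of_sq_le_sq _ (by positivity)
    linarith [circleFrequency_sq (c * k) s]
  have hks : 0 < |k * s| := abs_pos.2 (mul_ne_zero hk hs)
  rw [circleFunction, Complex.norm_real, norm_div, Real.norm_of_nonneg (by positivity : 0 ≤
    2 * circleFrequency (c * k) s), Real.norm_eq_abs, le_div_iff₀ hks, mul_div_assoc',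
    div_mul_eq_mul_div, div_le_one (by positivity)]
  calc |c| * |Real.sin (circleFrequency (c * k) s)| * |k * s| ≤ |c| * 1 * |k * s| := by
        gcongr
        exact Real.abs_sin_le_one _
    _ = |c * k * s| := by rw [mul_one, ← abs_mul, mul_assoc]
    _ ≤ _ := h1

theorem exists_circleFunction_ne_zero (k c : ℝ) : ∃ s ≠ 0, circleFunction k s c ≠ 0 := by
  have h0 : 0 < 1 + |c * k| := by positivity
  -- A radius this small keeps `|c k s| ≤ 1`, hence the frequency in `(0, 1]`, where the sine is
  -- positive.
  refine ⟨1 / (1 + |c * k|), by positivity, ?_⟩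
  set s := 1 / (1 + |c * k|) with hs
  have hω := circleFrequency_pos (c * k) s
  have h1 : |c * k * s| ≤ 1 := by
    rw [abs_mul, hs, abs_of_pos (by positivity : 0 < 1 / (1 + |c * k|)), mul_one_div,
      div_le_one h0]
    linarith
  have h2 : circleFrequency (c * k) s ≤ 1 := by
    have h3 := circleFrequency_sq (c * k) s
    have h4 : (c * k * s) ^ 2 ≤ 1 := by
      rw [← sq_abs]
      exact pow_le_one₀ (abs_nonneg _) h1
    nlinarith
  have h5 := Real.sin_pos_of_pos_of_lt_pi hω (by linarith [Real.pi_gt_three])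
  exact Complex.ofReal_ne_zero.2 (div_pos h5 (by positivity)).ne'

/-! ### Stone–Weierstrass on the one-point compactification of the line -/

theorem exp_mul_mem_vanishingAtInfinity (μ : ℝ) {v : ℝ → ℂ} (hv : v ∈ VanishingAtInfinity) :
    (fun c : ℝ => Complex.exp (Complex.I * (μ : ℂ) * (c : ℂ))) * v ∈ VanishingAtInfinity := by
  refine ⟨Continuous.mul (by fun_prop) hv.1,
    squeeze_zero_norm (a := fun c => ‖v c‖) (fun c => ?_) ?_⟩
  · rw [Pi.mul_apply, norm_mul, norm_exp_I_mul_mul, one_mul]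
  · simpa only [norm_zero] using hv.2.norm

/-- The extension by zero at infinity. -/
def extendByZero (v : ℝ → ℂ) (hv : v ∈ VanishingAtInfinity) : C(OnePoint ℝ, ℂ) :=
  OnePoint.continuousMapMk ⟨v, hv.1⟩ 0 (by
    rw [coclosedCompact_eq_cocompact]
    exact hv.2)

/-- Circle functions separate each finite point from infinity. Exponentials do not in general extend
to infinity, but their products with circle functions do, and these help separate finite points. -/
theorem vanishingAtInfinity_le_cylF {A : Connection} {k : ℝ} (hA : A.IsIsotropic k)
    (hk : k ≠ 0) : VanishingAtInfinity ≤ CylF A := by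
  intro v hv
  apply uniformClosure_map_cylFinite_le
  let B : StarSubalgebra ℂ C(OnePoint ℝ, ℂ) := (RayCylinder A).comap
    { toFun := fun (G : C(OnePoint ℝ, ℂ)) (c : ℝ) => G (c : OnePoint ℝ)
      map_one' := rfl
      map_mul' := fun _ _ => rfl
      map_zero' := rfl
      map_add' := fun _ _ => rfl
      commutes' := fun _ => rfl
      map_star' := fun _ => rfl }
  have hmem : ∀ (w : ℝ → ℂ) (hw : w ∈ VanishingAtInfinity), w ∈ RayCylinder A →
      extendByZero w hw ∈ B := fun w hw h => h
  have hinfty : ∀ x : ℝ, ∃ G ∈ B, G (x : OnePoint ℝ) ≠ G OnePoint.infty := by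
    intro x
    obtain ⟨s, hs, h⟩ := exists_circleFunction_ne_zero k x
    exact ⟨_, hmem _ (circleFunction_mem_vanishingAtInfinity hk hs)
      (circleFunction_mem_rayCylinder hA hs), h⟩
  have hB : B.SeparatesPoints := by
    intro x y hxy
    induction x using OnePoint.rec with
    | infty =>
      induction y using OnePoint.rec with
      | infty => exact absurd rfl hxy
      | coe y =>
        obtain ⟨G, hG, h⟩ := hinfty y
        exact ⟨G, ⟨G, hG, rfl⟩, h.symm⟩
    | coe x =>
      induction y using OnePoint.rec with
      | infty =>
        obtain ⟨G, hG, h⟩ := hinfty x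
        exact ⟨G, ⟨G, hG, rfl⟩, h⟩
      | coe y =>
        have hxy' : x ≠ y := fun h => hxy (congrArg _ h)
        obtain ⟨s, hs, h⟩ := exists_circleFunction_ne_zero k x
        have hw := circleFunction_mem_vanishingAtInfinity hk hs
        have hwA := circleFunction_mem_rayCylinder hA hs
        by_cases hne : circleFunction k s x = circleFunction k s y
        -- With this frequency the exponential changes sign between `x` and `y`, so the product
        -- separates them unless the circle function vanishes at `x`.
        · set μ := Real.pi / (x - y)
          refine ⟨_, ⟨_, hmem _ (exp_mul_mem_vanishingAtInfinity μ hw)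
            ((RayCylinder A).mul_mem (exp_mem_rayCylinder hA hk μ) hwA), rfl⟩, fun h' => h ?_⟩
          have h1 : Complex.exp (Complex.I * (μ : ℂ) * (x : ℂ)) * circleFunction k s x =
            Complex.exp (Complex.I * (μ : ℂ) * (y : ℂ)) * circleFunction k s y := h'
          have h2 : Complex.I * (μ : ℂ) * (x : ℂ) =
              Complex.I * (μ : ℂ) * (y : ℂ) + Real.pi * Complex.I := by
            have h3 : μ * (x - y) = Real.pi := div_mul_cancel₀ _ (sub_ne_zero.2 hxy')
            rw [← h3]
            push_cast
            ring
          rw [h2, Complex.exp_add, Complex.exp_pi_mul_I, ← hne] at h1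
          have h4 : Complex.exp (Complex.I * (μ : ℂ) * (y : ℂ)) * circleFunction k s x = 0 := by
            linear_combination -(1 / 2 : ℂ) * h1
          exact (mul_eq_zero.1 h4).resolve_left (Complex.exp_ne_zero _)
        · exact ⟨_, ⟨_, hmem _ hw hwA, rfl⟩, hne⟩
  have htop := ContinuousMap.starSubalgebra_topologicalClosure_eq_top_of_separatesPoints B hB
  have hvB : extendByZero v hv ∈ closure (B : Set C(OnePoint ℝ, ℂ)) := by
    rw [← StarSubalgebra.topologicalClosure_coe, htop]
    trivial
  intro ε hε
  obtain ⟨G, hG, hFG⟩ := Metric.mem_closure_iff.1 hvB ε hε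
  refine ⟨fun c => G (c : OnePoint ℝ), hG, fun c => ?_⟩
  have h1 := (ContinuousMap.dist_apply_le_dist (f := extendByZero v hv) (g := G)
    (c : OnePoint ℝ)).trans hFG.le
  rwa [dist_eq_norm] at h1

/-! ### The direct sum decomposition and its dual -/

theorem isDirectSum_cylF {A : Connection} {k : ℝ} (hA : A.IsIsotropic k) (hk : k ≠ 0) :
    IsDirectSum (CylF A) CylS VanishingAtInfinity where
  left_le := cylS_le_cylF hA hk
  right_le := vanishingAtInfinity_le_cylF hA hk
  isCompl := by
    refine ⟨Submodule.disjoint_def.2 fun x hS hV => ?_, codisjoint_iff_le_sup.2 fun x _ => ?_⟩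
    · exact Subtype.ext (Submodule.disjoint_def.1 disjoint_cylS_vanishingAtInfinity x hS hV)
    · obtain ⟨a, ha, v, hv, h⟩ := Submodule.mem_sup.1 (cylF_le hA hk x.2)
      exact Submodule.mem_sup.2 ⟨⟨a, cylS_le_cylF hA hk ha⟩, ha,
        ⟨v, vanishingAtInfinity_le_cylF hA hk hv⟩, hv, Subtype.ext h⟩

section DirectSum

variable {E : Type*} [AddCommGroup E] [Module ℂ E] {W S V : Submodule ℂ E}

theorem IsDirectSum.projLeft_left (h : IsDirectSum W S V) (x : S) :
    h.projLeft ⟨x, h.left_le x.2⟩ = x :=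
  congrArg (Submodule.submoduleOfEquivOfLe h.left_le)
    (Submodule.projectionOnto_apply_left h.isCompl ⟨⟨x, h.left_le x.2⟩, x.2⟩)

theorem IsDirectSum.projLeft_right (h : IsDirectSum W S V) (x : V) :
    h.projLeft ⟨x, h.right_le x.2⟩ = 0 :=
  congrArg (Submodule.submoduleOfEquivOfLe h.left_le)
    (Submodule.projectionOnto_apply_right h.isCompl ⟨⟨x, h.right_le x.2⟩, x.2⟩)

theorem IsDirectSum.projRight_left (h : IsDirectSum W S V) (x : S) :
    h.projRight ⟨x, h.left_le x.2⟩ = 0 :=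
  congrArg (Submodule.submoduleOfEquivOfLe h.right_le)
    (Submodule.projectionOnto_apply_right h.isCompl.symm ⟨⟨x, h.left_le x.2⟩, x.2⟩)

theorem IsDirectSum.projRight_right (h : IsDirectSum W S V) (x : V) :
    h.projRight ⟨x, h.right_le x.2⟩ = x :=
  congrArg (Submodule.submoduleOfEquivOfLe h.right_le)
    (Submodule.projectionOnto_apply_left h.isCompl.symm ⟨⟨x, h.right_le x.2⟩, x.2⟩)

/-- The inverse restricts a functional to the two summands: each projection is the identity on its
own summand and zero on the other, and the two projections add up to the identity. -/
theorem IsDirectSum.bijective_dualMap (h : IsDirectSum W S V) :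
    Function.Bijective h.dualMap := by
  constructor
  · rintro ⟨ψ₁, ψ₂⟩ ⟨χ₁, χ₂⟩ heq
    refine Prod.ext (LinearMap.ext fun x => ?_) (LinearMap.ext fun x => ?_)
    · simpa [dualMap, h.projLeft_left, h.projRight_left] using
        LinearMap.congr_fun heq ⟨x, h.left_le x.2⟩
    · simpa [dualMap, h.projLeft_right, h.projRight_right] using
        LinearMap.congr_fun heq ⟨x, h.right_le x.2⟩
  · intro χ
    refine ⟨(χ ∘ₗ Submodule.inclusion h.left_le, χ ∘ₗ Submodule.inclusion h.right_le),
      LinearMap.ext fun φ => ?_⟩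
    show χ _ + χ _ = χ φ
    rw [← map_add]
    exact congrArg χ (Subtype.ext (h.projLeft_add_projRight φ))

/-- The isomorphism between the sum of the duals and the dual of a direct sum. -/
def IsDirectSum.dualEquiv (h : IsDirectSum W S V) :
    (Module.Dual ℂ S × Module.Dual ℂ V) ≃ₗ[ℂ] Module.Dual ℂ W :=
  LinearEquiv.ofBijective
    { toFun := h.dualMap
      map_add' := fun ψ χ => by
        ext φ
        simp only [dualMap, Prod.fst_add, Prod.snd_add, LinearMap.add_apply, LinearMap.comp_apply]
        ring
      map_smul' := fun a ψ => by
        ext φ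
        simp [dualMap] }
    h.bijective_dualMap

end DirectSum

end LQC
end

theorem mainTheorem9 (Aref : LQC.Connection) (hinv : Aref.IsEuclideanInvariant)
    (hne : Aref.coeff ≠ 0) :
    ∃ h : LQC.IsDirectSum (LQC.CylF Aref) LQC.CylS LQC.VanishingAtInfinity,
      Function.Bijective h.dualMap ∧
      ∃ e : (Module.Dual ℂ LQC.CylS × Module.Dual ℂ LQC.VanishingAtInfinity) ≃ₗ[ℂ]
          Module.Dual ℂ (LQC.CylF Aref),
        ∀ (ψS : Module.Dual ℂ LQC.CylS) (ψV : Module.Dual ℂ LQC.VanishingAtInfinity)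
          (φ : LQC.CylF Aref),
          e (ψS, ψV) φ = ψS (h.projLeft φ) + ψV (h.projRight φ) := by
  obtain ⟨k, hk⟩ := hinv.exists_isIsotropic
  have hk0 : k ≠ 0 := by
    rintro rfl
    apply hne
    ext x a i
    simp [hk x a i]
  have h := LQC.isDirectSum_cylF hk hk0
  exact ⟨h, h.bijective_dualMap, h.dualEquiv, fun _ _ _ => rfl⟩
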